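/- Let $\mathfrak{M}$ be an $n$-dimensional matchbox manifold: a compact connected metric space with a finite foliated atlas $\varphi_i\colon \overline{U}_i \to [-1,1]^n\times \mathfrak{T}_i$, where the $\mathfrak{T}_i$ are totally disconnected, the open sets $U_i=\varphi_i^{-1}((-1,1)^n\times\mathfrak{T}_i)$ cover $\mathfrak{M}$, each plaque of $U_i$ meets at most one plaque of $U_j$, and the sets $\varphi_i^{-1}(\{0\}\times\mathfrak{T}_i)$ are pairwise disjoint. (Smoothness along the leaves is not needed.) Let $\mathcal{G}^*$ be its holonomy pseudo$\star$group on $\mathfrak{T}=\bigsqcup_i\mathfrak{T}_i$: the local homeomorphisms generated by the transition maps $h_{i,j}$ under composition, inversion and restriction to open sets. Let $d_{\mathfrak T}$ be the metric on $\mathfrak T$ induced from $\mathfrak{M}$ on each $\mathfrak{T}_i$, with value $\infty$ between different $\mathfrak{T}_i$. Assume that $\mathfrak{M}$ is equicontinuous: for every $\epsilon>0$ there is $\delta>0$ such that for all $\gamma\in\mathcal{G}^*$ and all $z,w$ in the domain of $\gamma$, $d_{\mathfrak T}(z,w)<\delta$ implies $d_{\mathfrak T}(\gamma z,\gamma w)<\epsilon$.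 Assume that $\mathfrak{M}$ has a leaf (path component) with non-trivial holonomy, that is, some $\gamma\in\mathcal{G}^*$ fixes a point $y\in\mathfrak{T}$ of the leaf and its germ at $y$ is not the germ of the identity. Consider any transverse section: a clopen set $V_0\subset\mathfrak{T}$, a group $G_0$ acting on $V_0$ by homeomorphisms and generating the restriction of $\mathcal{G}^*$ to $V_0$ (the germs of the maps $v\mapsto g\cdot v$, $g \in G_0$, at points of $V_0$ are exactly the germs of elements of $\mathcal{G}^*$ that map a point of $V_0$ into $V_0$), a point $x\in V_0$, and clopen sets $V_0\supset V_1\supset\cdots$ with $\bigcap_\ell V_\ell=\{x\}$ such that, for each $\ell$, the translates $gV_\ell$, $g \in G_0$, form a finite partition of $V_0$, with $\sup_{g}\operatorname{diam}(gV_\ell)\to0$ as $\ell \to \infty$. Let $G_\ell=\{g\in G_0: gV_\ell=V_\ell\}$ be the associated group chain. Then: 1. For every $k\ge0$ the discriminant group of the truncated chain $\{G_\ell\}_{\ell\ge k}$, $$\mathcal{D}^k=\varprojlim_{\ell\ge k} G_\ell/E_{k,\ell},\qquad E_{k,\ell}=\bigcap_{g\in G_k}gG_\ell g^{-1},$$ is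 non-trivial. 2. The Molino sequence of the section has non-trivial fibre. That is, let $\mathcal{P}=\{p_{\ell+1}\colon M_{\ell+1}\to M_\ell\}_{\ell \ge 0}$ be a presentation (covering maps of degree $>1$ between closed connected $n$-manifolds) with weak solenoid $\mathcal{S}_{\mathcal P}=\varprojlim M_\ell$, let $\Theta\colon\mathfrak{M}\to\mathcal{S}_{\mathcal P}$ be a homeomorphism that maps each $V_\ell$ onto the set of points of $\mathcal{S}_{\mathcal P}$ whose $\ell$-th coordinate is that of $\Theta(x)=(x_\ell)$, and let $G_0\cong\pi_1(M_0,x_0)$ be an isomorphism under which the action on $V_0$ is the monodromy action. Let $C_\ell$ be the core in $\pi_1(M_0,x_0)$ of the image of $\pi_1(M_\ell,x_\ell)$, let $\widehat{M}_\ell\to M_0$ be the covering associated to $C_\ell$, and let $\widehat{q}\colon\widehat{\mathcal S}_{\mathcal P}=\varprojlim\widehat{M}_\ell\to\mathcal{S}_{\mathcal P}$ be the induced map from the Molino space. Then every fibre of $\widehat{q}$ has more than one point. -/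

import Mathlib

open Set Filter Topology

universe u

noncomputable section

/-! ## Group chains and their discriminants -/

/-- A group chain in `G`: a descending chain `G = G₀ ⊇ G₁ ⊇ ⋯` of subgroups of finite index. -/
structure GroupChain (G : Type*) [Group G] where
  sub : ℕ → Subgroup G
  sub_zero : sub 0 = ⊤
  anti : Antitone sub
  finiteIndex : ∀ l, (sub l).FiniteIndex

namespace GroupChain

variable {G : Type*} [Group G] (H : GroupChain G)

/-- The core `C_l`: the largest normal subgroup of `G` that is contained in `G_l`. -/
def core (l : ℕ) : Subgroup G := (H.sub l).normalCore

instance core_normal (l : ℕ) : (H.core l).Normal := Subgroup.normalCore_normal _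

theorem core_succ_le (l : ℕ) : H.core (l + 1) ≤ H.core l :=
  Subgroup.normalCore_mono (H.anti (Nat.le_succ l))

/-- The bonding homomorphism `G ⧸ C_{l+1} → G ⧸ C_l`. -/
def bond (l : ℕ) : G ⧸ H.core (l + 1) →* G ⧸ H.core l :=
  QuotientGroup.map _ _ (MonoidHom.id G) (H.core_succ_le l)

/-- The discriminant group of the chain: the inverse limit of the groups `G_l ⧸ C_l`, realised as
the subgroup of `∏ G ⧸ C_l` of the bond-compatible sequences whose `l`-th entry lies in the image
`G_l ⧸ C_l` of `G_l`. -/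
def discriminant : Subgroup (∀ l, G ⧸ H.core l) where
  carrier := {d | (∀ l, d l ∈ (H.sub l).map (QuotientGroup.mk' (H.core l))) ∧
    ∀ l, H.bond l (d (l + 1)) = d l}
  one_mem' := ⟨fun _ => Subgroup.one_mem _, fun _ => map_one _⟩
  mul_mem' := fun {a b} ha hb => ⟨fun l => Subgroup.mul_mem _ (ha.1 l) (hb.1 l), fun l => by
    rw [Pi.mul_apply, map_mul, ha.2 l, hb.2 l, Pi.mul_apply]⟩
  inv_mem' := fun {a} ha => ⟨fun l => Subgroup.inv_mem _ (ha.1 l), fun l => by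
    rw [Pi.inv_apply, map_inv, ha.2 l, Pi.inv_apply]⟩

/-- The truncated chain `G_n ⊇ G_{n+1} ⊇ ⋯`, a group chain in the group `G_n`. -/
def truncate (n : ℕ) : GroupChain (H.sub n) where
  sub l := (H.sub (n + l)).subgroupOf (H.sub n)
  sub_zero := Subgroup.subgroupOf_self _
  anti := fun _ _ h => Subgroup.comap_mono (H.anti (Nat.add_le_add_left h n))
  finiteIndex l := by
    have := H.finiteIndex (n + l)
    infer_instance

end GroupChain

/-! ## Matchbox manifolds and their holonomy pseudo⋆group -/

/-- The closed cube `[-1,1]^n`. -/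
abbrev ClosedCube (n : ℕ) : Type := Set.Icc (-1 : Fin n → ℝ) 1

/-- The centre of the cube. -/
def ClosedCube.center (n : ℕ) : ClosedCube n :=
  ⟨0, fun _ => by simp, fun _ => by simp⟩

/-- A local foliation chart on `M`: a homeomorphism `φ` from a closed set (the closure of the chart
domain `U`) to `[-1,1]^n × T` with `T` totally disconnected, where the preimage `U` of
`(-1,1)^n × T` is open in `M`. -/
structure FoliationChart (M : Type u) [TopologicalSpace M] (n : ℕ) where
  T : Type u
  [topT : TopologicalSpace T]
  [totallyDisconnected : TotallyDisconnectedSpace T]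
  K : Set M
  isClosed_K : IsClosed K
  φ : K ≃ₜ ClosedCube n × T
  isOpen_U : IsOpen ((↑) '' {p : K | ∀ k, (φ p).1.1 k ∈ Set.Ioo (-1 : ℝ) 1} : Set M)

attribute [instance] FoliationChart.topT FoliationChart.totallyDisconnected

/-- The open chart domain `U = φ⁻¹((-1,1)^n × T)`. -/
def FoliationChart.U {M : Type u} [TopologicalSpace M] {n : ℕ} (C : FoliationChart M n) : Set M :=
  (↑) '' {p : C.K | ∀ k, (C.φ p).1.1 k ∈ Set.Ioo (-1 : ℝ) 1}

theorem FoliationChart.mem_K {M : Type u} [TopologicalSpace M] {n : ℕ} (C : FoliationChart M n)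
    {p : M} (hp : p ∈ C.U) : p ∈ C.K := by
  obtain ⟨q, _, rfl⟩ := hp
  exact q.2

/-- The local defining map `π = pr₂ ∘ φ`, on the open chart domain. Its fibres are the plaques. -/
def FoliationChart.plaque {M : Type u} [TopologicalSpace M] {n : ℕ} (C : FoliationChart M n)
    (p : C.U) : C.T := (C.φ ⟨p, C.mem_K p.2⟩).2

/-- A finite foliated atlas with leaf dimension `n` on `M`. Each plaque of one chart domain meets at
most one plaque of any other (this makes the holonomy maps well defined), and the embedded
transversals `φ_i⁻¹({0} × T_i)` are pairwise disjoint. -/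
structure FoliatedAtlas (M : Type u) [TopologicalSpace M] (n : ℕ) where
  ν : ℕ
  chart : Fin ν → FoliationChart M n
  cover : ⋃ i, (chart i).U = Set.univ
  regular : ∀ i j (p q : M) (hpi : p ∈ (chart i).U) (hpj : p ∈ (chart j).U)
    (hqi : q ∈ (chart i).U) (hqj : q ∈ (chart j).U),
    (chart i).plaque ⟨p, hpi⟩ = (chart i).plaque ⟨q, hqi⟩ →
    (chart j).plaque ⟨p, hpj⟩ = (chart j).plaque ⟨q, hqj⟩
  disjoint : ∀ i j, i ≠ j → ∀ (a : (chart i).T) (b : (chart j).T),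
    (((chart i).φ.symm (ClosedCube.center n, a) : (chart i).K) : M) ≠
      ((chart j).φ.symm (ClosedCube.center n, b) : (chart j).K)

namespace FoliatedAtlas

section Top

variable {M : Type u} [TopologicalSpace M] {n : ℕ} (A : FoliatedAtlas M n)

/-- The transverse space `𝔗 = 𝔗_1 ⊔ ⋯ ⊔ 𝔗_ν`. -/
abbrev Trans : Type u := Σ i, (A.chart i).T

/-- The embedding of the transverse space into `M`, onto `⋃ φ_i⁻¹({0} × T_i)`. -/
def emb (z : A.Trans) : M := ((A.chart z.1).φ.symm (ClosedCube.center n, z.2) : (A.chart z.1).K)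

/-- The local defining map of the `i`-th chart, with values in the transverse space. -/
def proj (i : Fin A.ν) (p : (A.chart i).U) : A.Trans := ⟨i, (A.chart i).plaque p⟩

/-- `A.HolRel i j z w`: some point of `U_i ∩ U_j` lies on the plaque `z` of the `i`-th chart and on
the plaque `w` of the `j`-th chart. This is the graph of `h_{i,j} = π_j ∘ π_i⁻¹`. -/
def HolRel (i j : Fin A.ν) (z w : A.Trans) : Prop :=
  ∃ (p : M) (hi : p ∈ (A.chart i).U) (hj : p ∈ (A.chart j).U),
    z = A.proj i ⟨p, hi⟩ ∧ w = A.proj j ⟨p, hj⟩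

theorem HolRel.symm {i j : Fin A.ν} {z w : A.Trans} (h : A.HolRel i j z w) : A.HolRel j i w z := by
  obtain ⟨p, hi, hj, h1, h2⟩ := h
  exact ⟨p, hj, hi, h2, h1⟩

theorem HolRel.unique {i j : Fin A.ν} {z w w' : A.Trans} (h : A.HolRel i j z w)
    (h' : A.HolRel i j z w') : w = w' := by
  obtain ⟨p, hi, hj, h1, rfl⟩ := h
  obtain ⟨q, hi', hj', h1', rfl⟩ := h'
  rw [h1] at h1'
  have := A.regular i j p q hi hj hi' hj' (by simpa [proj] using h1')
  simp [proj, this]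

open Classical in
/-- The map `h_{i,j}`, extended by the identity outside of its domain. -/
def holFun (i j : Fin A.ν) (z : A.Trans) : A.Trans :=
  if h : ∃ w, A.HolRel i j z w then h.choose else z

theorem HolRel.holFun_eq {i j : Fin A.ν} {z w : A.Trans} (h : A.HolRel i j z w) :
    A.holFun i j z = w := by
  have hex : ∃ w, A.HolRel i j z w := ⟨w, h⟩
  rw [holFun, dif_pos hex]
  exact HolRel.unique A hex.choose_spec h

/-- The domain `𝔗_{i,j} = π_i(U_i ∩ U_j)` of `h_{i,j}`. -/
def holDom (i j : Fin A.ν) : Set A.Trans := {z | ∃ w, A.HolRel i j z w}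

theorem HolRel.exists_local {i j : Fin A.ν} {z w : A.Trans} (h : A.HolRel i j z w) :
    ∃ (s : Type u) (_ : TopologicalSpace s) (e : s → A.Trans) (f : s → A.Trans) (a : s),
      IsOpenEmbedding e ∧ Continuous f ∧ e a = z ∧ ∀ b, A.HolRel i j (e b) (f b) := by
  obtain ⟨p, hi, hj, rfl, rfl⟩ := h
  set C := A.chart i with hC
  set c : ClosedCube n × C.T := C.φ ⟨p, C.mem_K hi⟩ with hc
  have hcint : ∀ k, c.1.1 k ∈ Set.Ioo (-1 : ℝ) 1 := by
    obtain ⟨q, hq, rfl⟩ := hi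
    exact hq
  let G : C.T → M := fun a => (C.φ.symm (c.1, a) : C.K)
  have hG : Continuous G := by fun_prop
  have hGU : ∀ a, G a ∈ C.U := fun a => ⟨C.φ.symm (c.1, a), by simpa using hcint, rfl⟩
  have hGpl : ∀ a, C.plaque ⟨G a, hGU a⟩ = a := by
    intro a
    simp [FoliationChart.plaque, G]
  have hGa : G c.2 = p := by
    simp [G, hc]
  let s : Set C.T := G ⁻¹' (A.chart j).U
  have hs : IsOpen s := (A.chart j).isOpen_U.preimage hG
  refine ⟨s, inferInstance, fun a => ⟨i, a.1⟩, fun a => A.proj j ⟨G a.1, a.2⟩,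
    ⟨c.2, by simpa [s, hGa] using hj⟩, ?_, ?_, ?_, ?_⟩
  · exact IsOpenEmbedding.sigmaMk.comp hs.isOpenEmbedding_subtypeVal
  · refine continuous_sigmaMk.comp ?_
    unfold FoliationChart.plaque
    refine continuous_snd.comp ((A.chart j).φ.continuous.comp ?_)
    exact Continuous.subtype_mk (hG.comp continuous_subtype_val) _
  · rfl
  · intro b
    exact ⟨G b.1, hGU b.1, b.2, by simp only [proj]; rw [hGpl], rfl⟩

theorem isOpen_holDom (i j : Fin A.ν) : IsOpen (A.holDom i j) := by
  rw [isOpen_iff_mem_nhds]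
  rintro z ⟨w, h⟩
  obtain ⟨s, _, e, f, a, he, -, rfl, hef⟩ := HolRel.exists_local A h
  exact Filter.mem_of_superset (he.isOpen_range.mem_nhds ⟨a, rfl⟩)
    (by rintro _ ⟨b, rfl⟩; exact ⟨f b, hef b⟩)

theorem continuousOn_holFun (i j : Fin A.ν) : ContinuousOn (A.holFun i j) (A.holDom i j) := by
  rintro z ⟨w, h⟩
  obtain ⟨s, _, e, f, a, he, hf, rfl, hef⟩ := HolRel.exists_local A h
  refine ContinuousAt.continuousWithinAt ((he.continuousAt_iff).1 ?_)
  have : A.holFun i j ∘ e = f := funext fun b => HolRel.holFun_eq A (hef b)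
  rw [this]
  exact hf.continuousAt

/-- The elementary holonomy homeomorphism `h_{i,j} : 𝔗_{i,j} → 𝔗_{j,i}`. -/
def hol (i j : Fin A.ν) : OpenPartialHomeomorph A.Trans A.Trans where
  toFun := A.holFun i j
  invFun := A.holFun j i
  source := A.holDom i j
  target := A.holDom j i
  map_source' := by
    rintro z ⟨w, h⟩
    rw [HolRel.holFun_eq A h]
    exact ⟨z, HolRel.symm A h⟩
  map_target' := by
    rintro z ⟨w, h⟩
    rw [HolRel.holFun_eq A h]
    exact ⟨z, HolRel.symm A h⟩
  left_inv' := by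
    rintro z ⟨w, h⟩
    rw [HolRel.holFun_eq A h, HolRel.holFun_eq A (HolRel.symm A h)]
  right_inv' := by
    rintro z ⟨w, h⟩
    rw [HolRel.holFun_eq A h, HolRel.holFun_eq A (HolRel.symm A h)]
  open_source := A.isOpen_holDom i j
  open_target := A.isOpen_holDom j i
  continuousOn_toFun := A.continuousOn_holFun i j
  continuousOn_invFun := A.continuousOn_holFun j i

/-- The holonomy pseudo⋆group `𝒢*` of the atlas: the local homeomorphisms obtained from the
elementary holonomy maps by composition, inversion and restriction to open subsets (no gluing). -/
inductive PseudoStarGroup : OpenPartialHomeomorph A.Trans A.Trans → Prop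
  | hol (i j : Fin A.ν) : PseudoStarGroup (A.hol i j)
  | comp {f g : OpenPartialHomeomorph A.Trans A.Trans} :
      PseudoStarGroup f → PseudoStarGroup g → PseudoStarGroup (f.trans g)
  | symm {f : OpenPartialHomeomorph A.Trans A.Trans} :
      PseudoStarGroup f → PseudoStarGroup f.symm
  | restr {f : OpenPartialHomeomorph A.Trans A.Trans} (s : Set A.Trans) (hs : IsOpen s) :
      PseudoStarGroup f → PseudoStarGroup (f.restrOpen s hs)

/-- The leaf through `m`, that is, the path component of `m`, has non-trivial holonomy: at some
point `y` of the transverse space on that leaf, some holonomy map fixes `y` but has a germ at `y`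
different from the germ of the identity. -/
def LeafHasNontrivialHolonomy (m : M) : Prop :=
  ∃ y : A.Trans, A.emb y ∈ pathComponent m ∧
    ∃ γ, A.PseudoStarGroup γ ∧ y ∈ γ.source ∧ γ y = y ∧ ¬ (γ : A.Trans → A.Trans) =ᶠ[𝓝 y] id

end Top

section Metric

variable {M : Type u} [MetricSpace M] {n : ℕ} (A : FoliatedAtlas M n)

open Classical in
/-- The distance `d_𝔗` on the transverse space: the distance in `M` between points of the same
`𝔗_i`, and `∞` between points of different ones. -/
def transDist (z w : A.Trans) : ENNReal :=
  if z.1 = w.1 then edist (A.emb z) (A.emb w) else ⊤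

/-- Equicontinuity of the holonomy pseudo⋆group. -/
def Equicontinuous : Prop :=
  ∀ ε > 0, ∃ δ > 0, ∀ γ, A.PseudoStarGroup γ → ∀ z ∈ γ.source, ∀ w ∈ γ.source,
    A.transDist z w < δ → A.transDist (γ z) (γ w) < ε

end Metric

end FoliatedAtlas

/-! ## Transverse sections with their group chains -/

/-- A transverse section of an atlas with holonomy group `G` and base point `x`: a clopen set
`V 0` in the transverse space, an action `Φ` of a group `G` on `V 0` by homeomorphisms which
generates the restriction of the holonomy pseudo⋆group to `V 0`, and a descending sequence of clopen
sets `V l` with intersection `{x}`, whose `G`-translates form finite partitions of `V 0` of mesh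
tending to zero. -/
structure TransverseSection {M : Type u} [MetricSpace M] {n : ℕ} (A : FoliatedAtlas M n)
    (G : Type*) [Group G] where
  V : ℕ → Set A.Trans
  x : A.Trans
  isClopen : ∀ l, IsClopen (V l)
  anti : Antitone V
  iInter : ⋂ l, V l = {x}
  Φ : G →* (V 0 ≃ₜ V 0)
  /-- Every element of `G` acts near every point as a holonomy map. -/
  isHolonomy : ∀ (g : G) (v : V 0), ∃ γ, A.PseudoStarGroup γ ∧ (v : A.Trans) ∈ γ.source ∧
    ∀ᶠ w : V 0 in 𝓝 v, γ (w : A.Trans) = Φ g w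
  /-- Every holonomy map acts, near every point of `V 0` that it maps to `V 0`, as some element
  of `G`. -/
  generates : ∀ γ, A.PseudoStarGroup γ → ∀ v : V 0, (v : A.Trans) ∈ γ.source →
    γ (v : A.Trans) ∈ V 0 → ∃ g : G, ∀ᶠ w : V 0 in 𝓝 v, γ (w : A.Trans) = Φ g w
  finite : ∀ l, (Set.range fun g : G => Φ g '' ((↑) ⁻¹' V l)).Finite
  covers : ∀ l (v : V 0), ∃ g : G, v ∈ Φ g '' ((↑) ⁻¹' V l)
  disjoint : ∀ l (g h : G), (Φ g '' ((↑) ⁻¹' V l) ∩ Φ h '' ((↑) ⁻¹' V l)).Nonempty →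
    Φ g '' ((↑) ⁻¹' V l) = Φ h '' ((↑) ⁻¹' V l)
  mesh : ∀ ε > 0, ∃ L, ∀ l ≥ L, ∀ g : G, ∀ v ∈ Φ g '' ((↑) ⁻¹' V l),
    ∀ w ∈ Φ g '' ((↑) ⁻¹' V l), A.transDist v w < ε

namespace TransverseSection

variable {M : Type u} [MetricSpace M] {n : ℕ} {A : FoliatedAtlas M n} {G : Type*} [Group G]
  (S : TransverseSection A G)

/-- `V l` as a subset of `V 0`. -/
def W (l : ℕ) : Set (S.V 0) := (↑) ⁻¹' S.V l

theorem x_mem (l : ℕ) : S.x ∈ S.V l := by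
  have h : S.x ∈ ⋂ l, S.V l := by rw [S.iInter]; rfl
  exact Set.mem_iInter.1 h l

/-- The base point as a point of `V 0`. -/
def base : S.V 0 := ⟨S.x, S.x_mem 0⟩

/-- The stabilizer `G_l = {g | g V_l = V_l}`. -/
def stab (l : ℕ) : Subgroup G where
  carrier := {g | S.Φ g '' S.W l = S.W l}
  one_mem' := by
    change S.Φ 1 '' S.W l = S.W l
    rw [map_one]
    exact Set.image_id _
  mul_mem' := fun {a b} (ha : S.Φ a '' _ = _) (hb : S.Φ b '' _ = _) => by
    change S.Φ (a * b) '' S.W l = S.W l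
    have : (S.Φ (a * b) : S.V 0 → S.V 0) = S.Φ a ∘ S.Φ b := by
      rw [map_mul]; rfl
    rw [this, Set.image_comp, hb, ha]
  inv_mem' := fun {a} (ha : S.Φ a '' _ = _) => by
    change S.Φ a⁻¹ '' S.W l = S.W l
    have h : (S.Φ a⁻¹ : S.V 0 → S.V 0) ∘ S.Φ a = id := by
      change ((S.Φ a⁻¹ * S.Φ a : S.V 0 ≃ₜ S.V 0) : S.V 0 → S.V 0) = id
      rw [← map_mul, inv_mul_cancel, map_one]; rfl
    conv_lhs => rw [← ha]
    rw [← Set.image_comp, h, Set.image_id]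

theorem image_mul (a b : G) (s : Set (S.V 0)) : S.Φ (a * b) '' s = S.Φ a '' (S.Φ b '' s) := by
  rw [← Set.image_comp, map_mul]; rfl

theorem mem_stab_iff (l : ℕ) (g : G) : g ∈ S.stab l ↔ S.Φ g S.base ∈ S.W l := by
  have hb : S.base ∈ S.W l := S.x_mem l
  constructor
  · intro h
    have h' : S.Φ g '' S.W l = S.W l := h
    rw [← h']
    exact ⟨_, hb, rfl⟩
  · intro h
    have h1 : S.Φ (1 : G) '' S.W l = S.W l := by rw [map_one]; exact Set.image_id _
    have := S.disjoint l g 1 ⟨S.Φ g S.base, ⟨_, hb, rfl⟩, by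
      change _ ∈ S.Φ (1 : G) '' S.W l
      rwa [h1]⟩
    exact Eq.trans this h1

/-- The group chain `G = G_0 ⊇ G_1 ⊇ ⋯` of the section at its base point. -/
def chain : GroupChain G where
  sub := S.stab
  sub_zero := by
    refine eq_top_iff.2 fun g _ => ?_
    rw [mem_stab_iff]
    exact (S.Φ g S.base).2
  anti := fun k l hkl g hg => by
    rw [mem_stab_iff] at hg ⊢
    exact S.anti hkl hg
  finiteIndex l := by
    have hf : Finite (Set.range fun g : G => S.Φ g '' S.W l) := (S.finite l).to_subtype
    have : Finite (G ⧸ S.stab l) := by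
      refine Finite.of_injective
        (Quotient.lift (s := QuotientGroup.leftRel (S.stab l))
          (fun g : G => (⟨S.Φ g '' S.W l, g, rfl⟩ : Set.range fun g : G => S.Φ g '' S.W l)) ?_) ?_
      · intro a b hab
        have hab' : a⁻¹ * b ∈ S.stab l := QuotientGroup.leftRel_apply.1 hab
        have h : S.Φ (a⁻¹ * b) '' S.W l = S.W l := hab'
        refine Subtype.ext ?_
        change S.Φ a '' S.W l = S.Φ b '' S.W l
        conv_lhs => rw [← h, ← image_mul, mul_inv_cancel_left]
      · rintro ⟨a⟩ ⟨b⟩ hab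
        have h : S.Φ a '' S.W l = S.Φ b '' S.W l := congrArg Subtype.val hab
        refine Quotient.sound (QuotientGroup.leftRel_apply.2 ?_)
        change S.Φ (a⁻¹ * b) '' S.W l = S.W l
        rw [image_mul, ← h, ← image_mul, inv_mul_cancel, map_one]
        exact Set.image_id _
    exact Subgroup.finiteIndex_of_finite_quotient

end TransverseSection

/-! ## Homotopy classes of paths from a base point -/

/-- The homotopy classes (relative to end points) of paths in `X` with initial point `x`. -/
abbrev PathsFrom {X : Type*} [TopologicalSpace X] (x : X) : Type _ :=
  Σ y, Path.Homotopic.Quotient x y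

namespace PathsFrom

variable {X E : Type*} [TopologicalSpace X] [TopologicalSpace E]

/-- Precomposition of a path class with a class of loops at the base point. -/
def act {x : X} (h : FundamentalGroup X x) (a : PathsFrom x) : PathsFrom x :=
  ⟨a.1, Path.Homotopic.Quotient.trans h a.2⟩

theorem act_one {x : X} (a : PathsFrom x) : act 1 a = a := by
  obtain ⟨y, c⟩ := a
  exact congrArg (Sigma.mk y) (Path.Homotopic.Quotient.refl_trans c)

theorem act_act {x : X} (g h : FundamentalGroup X x) (a : PathsFrom x) :
    act g (act h a) = act (h * g) a := by
  obtain ⟨y, c⟩ := a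
  exact congrArg (Sigma.mk y) (Path.Homotopic.Quotient.trans_assoc _ _ c).symm

/-- The image of a path class under a continuous map. -/
def map (f : C(E, X)) {e : E} {x : X} (h : f e = x) (a : PathsFrom e) : PathsFrom x :=
  ⟨f a.1, (a.2.map f).cast h.symm rfl⟩

theorem map_act (f : C(E, X)) {e : E} {x : X} (h : f e = x) (η : FundamentalGroup E e)
    (a : PathsFrom e) :
    map f h (act η a) = act (FundamentalGroup.mapOfEq f h η) (map f h a) := by
  subst h
  obtain ⟨y, c⟩ := a
  rw [FundamentalGroup.mapOfEq_apply]
  refine congrArg (Sigma.mk (f y)) ?_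
  obtain ⟨η⟩ := η
  obtain ⟨c⟩ := c
  refine congrArg Path.Homotopic.Quotient.mk ?_
  exact Path.map_trans _ _ f.continuous

theorem map_comp {Y : Type*} [TopologicalSpace Y] (f : C(E, X)) (g : C(X, Y)) {e : E} {x : X}
    {y : Y} (h : f e = x) (h' : g x = y) (h'' : (g.comp f) e = y) (a : PathsFrom e) :
    map (g.comp f) h'' a = map g h' (map f h a) := by
  subst h
  subst h'
  obtain ⟨z, c⟩ := a
  induction c using Path.Homotopic.Quotient.ind with | mk c =>
  rfl

theorem map_bijective (f : C(E, X)) (hf : IsCoveringMap f) {e : E} {x : X} (h : f e = x) :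
    Function.Bijective (map f h) := by
  subst h
  constructor
  · rintro ⟨y, c⟩ ⟨y', c'⟩ heq
    let F : PathsFrom (f e) → E := fun a => (hf.monodromy a.2 ⟨e, rfl⟩ : E)
    have hF : ∀ (z : E) (d : Path.Homotopic.Quotient e z), F (map f rfl ⟨z, d⟩) = z := by
      intro z d
      have := congrArg Subtype.val (hf.monodromy_map d)
      have h3 : F (map f rfl ⟨z, d⟩) =
        (hf.monodromy ((d.map f).cast rfl rfl) ⟨e, rfl⟩ : E) := rfl
      rw [h3, Path.Homotopic.Quotient.cast_rfl_rfl]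
      exact this
    have hy : y = y' := by rw [← hF y c, ← hF y' c', heq]
    subst hy
    have h2 := eq_of_heq (Sigma.mk.inj heq).2
    rw [Path.Homotopic.Quotient.cast_rfl_rfl, Path.Homotopic.Quotient.cast_rfl_rfl] at h2
    exact congrArg (Sigma.mk y) (hf.injective_path_homotopic_map e y h2)
  · rintro ⟨y, c⟩
    refine ⟨⟨_, hf.liftPathQuotient c ⟨e, rfl⟩⟩, ?_⟩
    have h1 := hf.map_liftPathQuotient c ⟨e, rfl⟩
    have h2 : f (hf.monodromy c ⟨e, rfl⟩) = y := (hf.monodromy c ⟨e, rfl⟩).2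
    refine Sigma.ext h2 ?_
    change HEq (((hf.liftPathQuotient c ⟨e, rfl⟩).map f).cast rfl rfl) c
    rw [Path.Homotopic.Quotient.cast_rfl_rfl]
    exact (heq_of_eq h1).trans (Path.Homotopic.Quotient.cast_heq _ _)

end PathsFrom

/-- Two classes of paths from `x` are identified when they differ by precomposition with an element
of `H`. -/
def coverSetoid {X : Type*} [TopologicalSpace X] (x : X) (H : Subgroup (FundamentalGroup X x)) :
    Setoid (PathsFrom x) where
  r a b := ∃ h ∈ H, b = PathsFrom.act h a
  iseqv :=
    { refl := fun a => ⟨1, H.one_mem, (PathsFrom.act_one a).symm⟩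
      symm := by
        rintro a _ ⟨h, hh, rfl⟩
        refine ⟨h⁻¹, H.inv_mem hh, ?_⟩
        rw [PathsFrom.act_act, mul_inv_cancel, PathsFrom.act_one]
      trans := by
        rintro a _ _ ⟨h, hh, rfl⟩ ⟨g, hg, rfl⟩
        exact ⟨h * g, H.mul_mem hh hg, PathsFrom.act_act _ _ _⟩ }

/-- The covering space of `X` associated to a subgroup `H` of `π₁(X, x)`: the space of classes of
paths from `x`, modulo precomposition with elements of `H`. -/
def AssociatedCover {X : Type*} [TopologicalSpace X] (x : X)
    (H : Subgroup (FundamentalGroup X x)) : Type _ :=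
  Quotient (coverSetoid x H)

/-- The topology on the associated covering space is the quotient topology of the compact-open
topology on the space of paths from `x`. -/
instance {X : Type*} [TopologicalSpace X] (x : X) (H : Subgroup (FundamentalGroup X x)) :
    TopologicalSpace (AssociatedCover x H) :=
  TopologicalSpace.coinduced
    (fun c : {c : C(unitInterval, X) // c 0 = x} =>
      (Quotient.mk (coverSetoid x H)
        ⟨c.1 1, Path.Homotopic.Quotient.mk ⟨c.1, c.2, rfl⟩⟩ : AssociatedCover x H))
    inferInstance

/-- The projection of the associated covering spaces induced by an inclusion of subgroups. -/
def AssociatedCover.project {X : Type*} [TopologicalSpace X] {x : X}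
    {H H' : Subgroup (FundamentalGroup X x)} (hle : H ≤ H') :
    AssociatedCover x H → AssociatedCover x H' :=
  Quotient.map' id fun _ _ ⟨h, hh, e⟩ => ⟨h, hle hh, e⟩

/-! ## Weak solenoids and their Molino spaces -/

/-- A presentation of a weak solenoid: a sequence of covering maps of degree greater than one
between closed connected `n`-manifolds. -/
structure Presentation (n : ℕ) where
  M : ℕ → Type u
  [top : ∀ l, TopologicalSpace (M l)]
  [t2 : ∀ l, T2Space (M l)]
  [compact : ∀ l, CompactSpace (M l)]
  [connected : ∀ l, ConnectedSpace (M l)]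
  [manifold : ∀ l, ChartedSpace (EuclideanSpace ℝ (Fin n)) (M l)]
  p : ∀ l, C(M (l + 1), M l)
  isCoveringMap : ∀ l, IsCoveringMap (p l)
  one_lt_degree : ∀ l y, 1 < (p l ⁻¹' {y}).ncard

attribute [instance] Presentation.top Presentation.t2 Presentation.compact Presentation.connected
  Presentation.manifold

namespace Presentation

variable {n : ℕ} (P : Presentation.{u} n)

/-- The weak solenoid: the inverse limit of the presentation. -/
def Solenoid : Type u := {s : ∀ l, P.M l // ∀ l, P.p l (s (l + 1)) = s l}

instance : TopologicalSpace P.Solenoid := instTopologicalSpaceSubtype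

/-- The projection of the solenoid to the base manifold. -/
def toBase : C(P.Solenoid, P.M 0) :=
  ⟨fun s => s.1 0, (continuous_apply 0).comp continuous_subtype_val⟩

/-- The covering map `q_l : M_l → M_0`. -/
def q : ∀ l, C(P.M l, P.M 0)
  | 0 => ContinuousMap.id _
  | l + 1 => (q l).comp (P.p l)

variable (s : P.Solenoid)

theorem q_apply : ∀ l, P.q l (s.1 l) = s.1 0
  | 0 => rfl
  | l + 1 => by
    change P.q l (P.p l (s.1 (l + 1))) = s.1 0
    rw [s.2 l]
    exact q_apply l

/-- The group chain of the presentation at the base point `s`: the image of `π₁(M_l, s_l)` in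
`π₁(M_0, s_0)`. -/
def imageGroup (l : ℕ) : Subgroup (FundamentalGroup (P.M 0) (s.1 0)) :=
  (FundamentalGroup.mapOfEq (P.q l) (P.q_apply s l)).range

/-- The core of `imageGroup l` in `π₁(M_0, s_0)`. -/
def coreGroup (l : ℕ) : Subgroup (FundamentalGroup (P.M 0) (s.1 0)) := (P.imageGroup s l).normalCore

/-- The push-forward of paths in `M_l` from `s_l` to paths in `M_0` from `s_0`. -/
def push (l : ℕ) : PathsFrom (s.1 l) → PathsFrom (s.1 0) := PathsFrom.map (P.q l) (P.q_apply s l)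

theorem push_succ (l : ℕ) (a : PathsFrom (s.1 (l + 1))) :
    P.push s (l + 1) a = P.push s l (PathsFrom.map (P.p l) (s.2 l) a) :=
  PathsFrom.map_comp (P.p l) (P.q l) (s.2 l) (P.q_apply s l) (P.q_apply s (l + 1)) a

theorem push_bijective (l : ℕ) : Function.Bijective (P.push s l) := by
  induction l with
  | zero =>
    have : P.push s 0 = id := by
      funext ⟨y, c⟩
      induction c using Path.Homotopic.Quotient.ind with | mk c =>
      rfl
    rw [this]
    exact Function.bijective_id
  | succ l ih =>
    have : P.push s (l + 1) = P.push s l ∘ PathsFrom.map (P.p l) (s.2 l) :=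
      funext (P.push_succ s l)
    rw [this]
    exact ih.comp (PathsFrom.map_bijective _ (P.isCoveringMap l) _)

/-- The lift of path classes in `M_0` from `s_0` to path classes in `M_l` from `s_l`. -/
def lift (l : ℕ) (a : PathsFrom (s.1 0)) : PathsFrom (s.1 l) :=
  (Equiv.ofBijective _ (P.push_bijective s l)).symm a

theorem push_lift (l : ℕ) (a : PathsFrom (s.1 0)) : P.push s l (P.lift s l a) = a :=
  (Equiv.ofBijective _ (P.push_bijective s l)).apply_symm_apply a

theorem imageGroup_succ_le (l : ℕ) : P.imageGroup s (l + 1) ≤ P.imageGroup s l := by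
  rintro _ ⟨η, rfl⟩
  refine ⟨FundamentalGroup.mapOfEq (P.p l) (s.2 l) η, ?_⟩
  have h : (⟨_, FundamentalGroup.mapOfEq (P.q (l + 1)) (P.q_apply s (l + 1)) η⟩ :
      PathsFrom (s.1 0)) = ⟨_, FundamentalGroup.mapOfEq (P.q l) (P.q_apply s l)
        (FundamentalGroup.mapOfEq (P.p l) (s.2 l) η)⟩ := by
    have key : ∀ {X E : Type u} [TopologicalSpace X] [TopologicalSpace E] (f : C(E, X)) {e : E}
        {x : X} (h : f e = x) (η : FundamentalGroup E e),
        (⟨x, FundamentalGroup.mapOfEq f h η⟩ : PathsFrom x) = PathsFrom.map f h ⟨e, η⟩ := by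
      intro X E _ _ f e x h η
      subst h
      rw [FundamentalGroup.mapOfEq_apply]
      rfl
    rw [key, key, key]
    exact P.push_succ s l _
  exact (eq_of_heq (Sigma.mk.inj h).2).symm

theorem coreGroup_succ_le (l : ℕ) : P.coreGroup s (l + 1) ≤ P.coreGroup s l :=
  Subgroup.normalCore_mono (P.imageGroup_succ_le s l)

/-- The `l`-th stage `M̂_l` of the Molino tower: the covering space of `M_0` associated to the
core subgroup. -/
abbrev MolinoStage (l : ℕ) : Type u := AssociatedCover (s.1 0) (P.coreGroup s l)

/-- The Molino space: the inverse limit of the tower of the covering spaces `M̂_l`. -/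
def MolinoSpace : Type u :=
  {z : ∀ l, P.MolinoStage s l //
    ∀ l, AssociatedCover.project (P.coreGroup_succ_le s l) (z (l + 1)) = z l}

instance : TopologicalSpace (P.MolinoSpace s) := instTopologicalSpaceSubtype

/-- The covering map `M̂_l → M_l`: a path class in `M_0` from `s_0` is sent to the end point of its
lift to `M_l` with initial point `s_l`. -/
def stageMap (l : ℕ) : P.MolinoStage s l → P.M l :=
  Quotient.lift (fun a => (P.lift s l a).1) (by
    rintro a _ ⟨h, hh, rfl⟩
    obtain ⟨η, rfl⟩ := Subgroup.normalCore_le _ hh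
    have : P.lift s l (PathsFrom.act
        (FundamentalGroup.mapOfEq (P.q l) (P.q_apply s l) η) a) =
        PathsFrom.act η (P.lift s l a) := by
      apply (P.push_bijective s l).1
      rw [push_lift]
      refine Eq.trans ?_ (PathsFrom.map_act (P.q l) (P.q_apply s l) η _).symm
      exact congrArg _ (P.push_lift s l a).symm
    change (P.lift s l a).1 = (P.lift s l (PathsFrom.act _ a)).1
    rw [this]
    rfl)

theorem p_stageMap (l : ℕ) (z : P.MolinoStage s (l + 1)) :
    P.p l (P.stageMap s (l + 1) z) =
      P.stageMap s l (AssociatedCover.project (P.coreGroup_succ_le s l) z) := by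
  obtain ⟨a⟩ := z
  change (PathsFrom.map (P.p l) (s.2 l) (P.lift s (l + 1) a)).1 = (P.lift s l a).1
  refine congrArg Sigma.fst ((P.push_bijective s l).1 ?_)
  rw [← push_succ, push_lift, push_lift]

/-- The projection of the Molino sequence `𝒟 → Ŝ → S`, from the Molino space to the solenoid. -/
def molinoMap (z : P.MolinoSpace s) : P.Solenoid :=
  ⟨fun l => P.stageMap s l (z.1 l), fun l => by rw [p_stageMap, z.2 l]⟩

end Presentation

/-- A presentation of `M` adapted to a transverse section: a homeomorphism from `M` to the weak
solenoid which carries `V l` to the fibre of the projection to `M_l` through the base point, and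
an isomorphism of `G` with `π₁(M_0)` under which the action on `V 0` is the monodromy action: the
path in the solenoid that starts at (the image of) `v` and lifts a loop in the class of `g` ends at
(the image of) `g • v`. -/
structure TransverseSection.Realization {M : Type u} [MetricSpace M] {n : ℕ}
    {A : FoliatedAtlas M n} {G : Type*} [Group G] (S : TransverseSection A G)
    (P : Presentation.{u} n) where
  Θ : M ≃ₜ P.Solenoid
  image_V : ∀ l, (fun z => Θ (A.emb z)) '' S.V l =
    {s : P.Solenoid | s.1 l = (Θ (A.emb S.x)).1 l}
  e : G ≃* FundamentalGroup (P.M 0) ((Θ (A.emb S.x)).1 0)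
  monodromy : ∀ (g : G) (v : S.V 0),
    ∃ (c : Path (Θ (A.emb v)) (Θ (A.emb (S.Φ g v))))
      (h₀ : (Θ (A.emb S.x)).1 0 = P.toBase (Θ (A.emb v)))
      (h₁ : (Θ (A.emb S.x)).1 0 = P.toBase (Θ (A.emb (S.Φ g v)))),
      e g = Path.Homotopic.Quotient.mk ((c.map P.toBase.continuous).cast h₀ h₁)

end

/-! Equicontinuity and compactness provide a `δ > 0` such that every holonomy map agrees at a
given point of its domain with a holonomy map defined on the whole `δ`-ball around that point:
follow a chain of plaques, whose consecutive charts overlap uniformly well. Hence the holonomy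
saturation of a clopen set is clopen, and by connectedness every leaf meets `V 0`. A non-trivial
holonomy germ can therefore be conjugated into `V 0`, where it is the germ of some `g ∈ G` at a
fixed point.

Let `k ≥ 0`. If the discriminant of the chain truncated at `k` were trivial, then, by compactness
of inverse limits of finite sets, every core would contain a whole group `G_m`. The conjugates of
the `G_m` contain the stabilizers of the points of `V_k`, so an element with a fixed point in
`V_k` would lie in all the cores, that is, preserve all the translates of the `V_l` inside `V_k`;
as these shrink to points it would be the identity on `V_k`, contradicting the existence of `g`.

The discriminant acts by deck transformations, freely, on the Molino space, and preserves the
fibres of the map to the solenoid. -/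

theorem exists_compatible_sequence {X : ℕ → Type*} (f : ∀ l, X (l + 1) → X l)
    (F : ∀ l, Set (X l)) (hfin : ∀ l, (F l).Finite) (hne : ∀ l, (F l).Nonempty)
    (hf : ∀ l, MapsTo (f l) (F (l + 1)) (F l)) :
    ∃ x : ∀ l, X l, (∀ l, x l ∈ F l) ∧ ∀ l, f l (x (l + 1)) = x l := by
  let D : CategoryTheory.Functor ℕᵒᵖ (Type _) :=
    CategoryTheory.Functor.ofOpSequence (X := fun l => F l) fun l =>
      TypeCat.ofHom fun x => (⟨f l x, hf l x.2⟩ : F l)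
  have : ∀ j, Finite (D.obj j) := fun j => (hfin j.unop).to_subtype
  have : ∀ j, Nonempty (D.obj j) := fun j => (hne j.unop).to_subtype
  obtain ⟨x, hx⟩ := nonempty_sections_of_finite_inverse_system D
  refine ⟨fun l => (x (Opposite.op l) : F l).1, fun l => (x (Opposite.op l) : F l).2, fun l => ?_⟩
  have h := hx (CategoryTheory.homOfLE (Nat.le_succ l)).op
  rw [CategoryTheory.Functor.ofOpSequence_map_homOfLE_succ] at h
  exact congrArg Subtype.val h

theorem exists_shrinking_of_isClosed_subset {ι X : Type*} [TopologicalSpace X] [NormalSpace X]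
    {U F : ι → Set X} (hU : ∀ i, IsOpen (U i)) (hfin : ∀ x, {i | x ∈ U i}.Finite)
    (hcover : ⋃ i, U i = univ) (hF : ∀ i, IsClosed (F i)) (hFU : ∀ i, F i ⊆ U i) :
    ∃ v : ι → Set X, (∀ i, IsOpen (v i)) ∧ ⋃ i, v i = univ ∧ (∀ i, closure (v i) ⊆ U i) ∧
      ∀ i, F i ⊆ v i := by
  obtain ⟨v, hv, hvo, hvU⟩ := exists_iUnion_eq_closure_subset hU hfin hcover
  choose w hwo hFw hwU using fun i => normal_exists_closure_subset (hF i) (hU i) (hFU i)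
  refine ⟨fun i => v i ∪ w i, fun i => (hvo i).union (hwo i), ?_, fun i => ?_,
    fun i => (hFw i).trans subset_union_right⟩
  · exact univ_subset_iff.1 (hv.ge.trans (iUnion_mono fun i => subset_union_left))
  · exact closure_union.trans_subset (union_subset (hvU i) (hwU i))

theorem eventuallyEq_id_of_conj_eventuallyEq_id {X Y : Type*} [TopologicalSpace X]
    [TopologicalSpace Y] (η : OpenPartialHomeomorph X Y) {γ : X → X} {y : X} (hy : y ∈ η.source)
    (hγ : ContinuousAt γ y) (hfix : γ y = y) (h : η ∘ γ ∘ η.symm =ᶠ[𝓝 (η y)] id) :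
    γ =ᶠ[𝓝 y] id := by
  have hγη : ∀ᶠ w in 𝓝 y, γ w ∈ η.source :=
    hγ.eventually_mem (by rw [hfix]; exact η.open_source.mem_nhds hy)
  filter_upwards [(η.continuousAt hy).eventually h, η.open_source.mem_nhds hy, hγη]
    with w hconj hw hγw
  rw [Function.comp_apply, Function.comp_apply, η.left_inv hw] at hconj
  exact η.injOn hγw hw hconj

/-! ## Group chains with trivial discriminant -/

namespace GroupChain

variable {G : Type*} [Group G] (H : GroupChain G)

variable {H} in
theorem apply_eq_mk_of_le {d : ∀ l, G ⧸ H.core l} (hd : d ∈ H.discriminant) {l n : ℕ} (h : l ≤ n)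
    {g : G} (hg : d n = QuotientGroup.mk g) : d l = QuotientGroup.mk g := by
  induction n, h using Nat.le_induction with
  | base => exact hg
  | succ n _ ih => exact ih (by rw [← hd.2 n, hg]; rfl)

theorem nontrivial_discriminant_iff :
    Nontrivial H.discriminant ↔ ∃ l, ∀ m, ¬ H.sub m ≤ H.core l := by
  constructor
  · intro _
    obtain ⟨d, hd⟩ := exists_ne (1 : H.discriminant)
    obtain ⟨l, hl⟩ := Function.ne_iff.1 (Subtype.coe_injective.ne hd)
    refine ⟨l, fun m hm => hl ?_⟩
    obtain ⟨g, hg, hgd⟩ := d.2.1 (max l m)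
    rw [apply_eq_mk_of_le d.2 (le_max_left l m) hgd.symm]
    exact (QuotientGroup.eq_one_iff g).2 (hm (H.anti (le_max_right l m) hg))
  · rintro ⟨k, hk⟩
    have finite_quotient (l : ℕ) : Finite (G ⧸ H.core l) := by
      have := H.finiteIndex l
      exact inferInstanceAs (Finite (G ⧸ (H.sub l).normalCore))
    obtain ⟨d, hd, hbond⟩ := exists_compatible_sequence (fun l => H.bond l)
      (fun l => (QuotientGroup.mk : G → G ⧸ H.core l) '' (H.sub l \ H.core k))
      (fun l => toFinite _) (fun l => (sdiff_nonempty.2 (hk l)).image _) (fun l => by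
        rintro _ ⟨g, ⟨hg, hgk⟩, rfl⟩
        exact ⟨g, ⟨H.anti l.le_succ hg, hgk⟩, rfl⟩)
    refine ⟨⟨d, fun l => image_mono sdiff_subset (hd l), hbond⟩, 1, fun h => ?_⟩
    obtain ⟨g, ⟨-, hgk⟩, hg⟩ := hd k
    refine hgk ((QuotientGroup.eq_one_iff g).1 (hg.trans ?_))
    exact congrFun (congrArg Subtype.val h) k

variable {H} {G' : Type*} [Group G'] {H' : GroupChain G'}

theorem apply_mem_core_iff (e : G ≃* G') {l : ℕ} (he : ∀ g, e g ∈ H'.sub l ↔ g ∈ H.sub l) (g : G) :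
    e g ∈ H'.core l ↔ g ∈ H.core l := by
  have hconj (b : G) : e b * e g * (e b)⁻¹ ∈ H'.sub l ↔ b * g * b⁻¹ ∈ H.sub l := by
    rw [← he, map_mul, map_mul, map_inv]
  exact e.surjective.forall.trans (forall_congr' hconj)

theorem nontrivial_discriminant_congr (e : G ≃* G')
    (he : ∀ l g, e g ∈ H'.sub l ↔ g ∈ H.sub l) :
    Nontrivial H.discriminant ↔ Nontrivial H'.discriminant := by
  have hle (l m : ℕ) : H.sub m ≤ H.core l ↔ H'.sub m ≤ H'.core l := by
    simp only [SetLike.le_def, e.surjective.forall, he, apply_mem_core_iff e (he l)]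
  simp only [nontrivial_discriminant_iff, hle]

end GroupChain

/-! ## Plaques and holonomy maps -/

theorem FoliationChart.isPreconnected_plaque {M : Type*} [TopologicalSpace M] {n : ℕ}
    (C : FoliationChart M n) (t : C.T) : IsPreconnected {p : C.U | C.plaque p = t} := by
  let cube : Set (ClosedCube n) := Subtype.val ⁻¹' (univ.pi fun _ => Ioo (-1 : ℝ) 1)
  have hcube : IsPreconnected cube := by
    refine IsInducing.subtypeVal.isPreconnected_image.1 ?_
    rw [Subtype.image_preimage_coe, inter_eq_right.2]
    · exact (convex_pi fun _ _ => convex_Ioo (-1 : ℝ) 1).isPreconnected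
    · exact fun c hc => ⟨fun k => (hc k trivial).1.le, fun k => (hc k trivial).2.le⟩
  have hplaque : ((↑) '' {p : C.U | C.plaque p = t} : Set M) = (↑) '' (C.φ ⁻¹' (cube ×ˢ {t})) := by
    ext p
    constructor
    · rintro ⟨⟨_, q, hq, rfl⟩, hqt, rfl⟩
      exact ⟨q, ⟨fun k _ => hq k, hqt⟩, rfl⟩
    · rintro ⟨q, ⟨hq, hqt⟩, rfl⟩
      exact ⟨⟨q, q, fun k => hq k trivial, rfl⟩, hqt, rfl⟩
  rw [← IsInducing.subtypeVal.isPreconnected_image, hplaque,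
    IsInducing.subtypeVal.isPreconnected_image, C.φ.isPreconnected_preimage]
  exact hcube.prod isPreconnected_singleton

namespace FoliatedAtlas

section Top

variable {M : Type*} [TopologicalSpace M] {n : ℕ} (A : FoliatedAtlas M n)

theorem emb_injective : Function.Injective A.emb := by
  rintro ⟨i, a⟩ ⟨j, b⟩ h
  obtain rfl : i = j := by
    by_contra hij
    exact A.disjoint i j hij a b h
  have hab := (A.chart i).φ.symm.injective (Subtype.ext h)
  exact congrArg (Sigma.mk i) (Prod.mk.inj hab).2

theorem continuous_emb : Continuous A.emb :=
  continuous_sigma fun i => continuous_subtype_val.comp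
    ((A.chart i).φ.symm.continuous.comp (continuous_const.prodMk continuous_id))

theorem emb_mem_U (z : A.Trans) : A.emb z ∈ (A.chart z.1).U :=
  ⟨(A.chart z.1).φ.symm (ClosedCube.center n, z.2), by simp [ClosedCube.center], rfl⟩

theorem proj_emb (z : A.Trans) : A.proj z.1 ⟨A.emb z, A.emb_mem_U z⟩ = z :=
  Sigma.ext rfl (heq_of_eq (congrArg Prod.snd ((A.chart z.1).φ.apply_symm_apply _)))

theorem continuous_proj (i : Fin A.ν) : Continuous (A.proj i) :=
  continuous_sigmaMk.comp (continuous_snd.comp ((A.chart i).φ.continuous.comp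
    (continuous_subtype_val.subtype_mk _)))

theorem isPreconnected_proj_preimage (i : Fin A.ν) (z : A.Trans) :
    IsPreconnected (A.proj i ⁻¹' {z}) := by
  obtain ⟨j, t⟩ := z
  by_cases hij : i = j
  · subst hij
    convert (A.chart i).isPreconnected_plaque t using 1
    ext p
    simp [proj]
  · convert isPreconnected_empty
    ext p
    simp [proj, hij]

variable {A} {i j : Fin A.ν} {p q : M}

theorem proj_eq_proj_of_proj_eq_proj {hpi : p ∈ (A.chart i).U} {hqi : q ∈ (A.chart i).U}
    (hpj : p ∈ (A.chart j).U) (hqj : q ∈ (A.chart j).U)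
    (h : A.proj i ⟨p, hpi⟩ = A.proj i ⟨q, hqi⟩) : A.proj j ⟨p, hpj⟩ = A.proj j ⟨q, hqj⟩ :=
  congrArg (Sigma.mk j) (A.regular i j p q hpi hpj hqi hqj (eq_of_heq (Sigma.mk.inj h).2))

theorem holRel_proj (hi : p ∈ (A.chart i).U) (hj : p ∈ (A.chart j).U) :
    A.HolRel i j (A.proj i ⟨p, hi⟩) (A.proj j ⟨p, hj⟩) :=
  ⟨p, hi, hj, rfl, rfl⟩

theorem proj_mem_source_hol (hi : p ∈ (A.chart i).U) (hj : p ∈ (A.chart j).U) :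
    A.proj i ⟨p, hi⟩ ∈ (A.hol i j).source :=
  ⟨_, holRel_proj hi hj⟩

theorem hol_proj (hi : p ∈ (A.chart i).U) (hj : p ∈ (A.chart j).U) :
    A.hol i j (A.proj i ⟨p, hi⟩) = A.proj j ⟨p, hj⟩ :=
  HolRel.holFun_eq A (holRel_proj hi hj)

/-! ## Chains of plaques -/

variable (A) in
/-- A shrinking of the chart domains: an open cover by sets whose closures lie in the chart
domains. -/
structure IsShrinking (v : Fin A.ν → Set M) : Prop where
  isOpen : ∀ i, IsOpen (v i)
  iUnion_eq : ⋃ i, v i = univ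
  closure_subset : ∀ i, closure (v i) ⊆ (A.chart i).U

variable {v : Fin A.ν → Set M}

theorem IsShrinking.subset (hv : A.IsShrinking v) (i : Fin A.ν) : v i ⊆ (A.chart i).U :=
  subset_closure.trans (hv.closure_subset i)

variable (A v) in
/-- Two points of `v i` are linked if they lie on the same plaque of the `i`-th chart. -/
def PlaqueLinked (p q : M) : Prop :=
  ∃ (i : Fin A.ν) (hp : p ∈ (A.chart i).U) (hq : q ∈ (A.chart i).U),
    p ∈ v i ∧ q ∈ v i ∧ A.proj i ⟨p, hp⟩ = A.proj i ⟨q, hq⟩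

theorem PlaqueLinked.symm (h : A.PlaqueLinked v p q) : A.PlaqueLinked v q p := by
  obtain ⟨i, hp, hq, hpv, hqv, hpq⟩ := h
  exact ⟨i, hq, hp, hqv, hpv, hpq.symm⟩

variable (A v) in
/-- The plaque chain relation: the equivalence relation in `M` generated by the linked pairs of
points. -/
def PlaqueChained : M → M → Prop := Relation.ReflTransGen (A.PlaqueLinked v)

theorem PlaqueChained.symm (h : A.PlaqueChained v p q) : A.PlaqueChained v q p := by
  have : Std.Symm (A.PlaqueLinked v) := ⟨fun _ _ => PlaqueLinked.symm⟩
  exact Relation.ReflTransGen.stdSymm.symm _ _ h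

theorem PlaqueChained.trans {r : M} (hpq : A.PlaqueChained v p q) (hqr : A.PlaqueChained v q r) :
    A.PlaqueChained v p r :=
  Relation.ReflTransGen.trans hpq hqr

namespace IsShrinking

theorem plaqueChained_of_proj_eq (hv : A.IsShrinking v) {hp : p ∈ (A.chart i).U}
    {hq : q ∈ (A.chart i).U} (h : A.proj i ⟨p, hp⟩ = A.proj i ⟨q, hq⟩) :
    A.PlaqueChained v p q := by
  refine (A.isPreconnected_proj_preimage i (A.proj i ⟨q, hq⟩)).induction₂
    (fun a b : (A.chart i).U => A.PlaqueChained v a b) (fun a ha => ?_)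
    (fun _ _ _ _ _ _ => PlaqueChained.trans) (fun _ _ _ _ => PlaqueChained.symm)
    (x := ⟨p, hp⟩) (y := ⟨q, hq⟩) h rfl
  obtain ⟨j, hj⟩ := iUnion_eq_univ_iff.1 hv.iUnion_eq a
  filter_upwards [self_mem_nhdsWithin, mem_nhdsWithin_of_mem_nhds
    (((hv.isOpen j).preimage continuous_subtype_val).mem_nhds hj)] with b hb hbj
  exact .single ⟨j, hv.subset j hj, hv.subset j hbj, hj, hbj,
    proj_eq_proj_of_proj_eq_proj _ _ (ha.trans hb.symm)⟩

theorem plaqueChained_of_pseudoStarGroup (hv : A.IsShrinking v)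
    {γ : OpenPartialHomeomorph A.Trans A.Trans} (hγ : A.PseudoStarGroup γ) {z : A.Trans}
    (hz : z ∈ γ.source) : A.PlaqueChained v (A.emb z) (A.emb (γ z)) := by
  induction hγ generalizing z with
  | hol i j =>
    obtain ⟨_, p, hi, hj, rfl, rfl⟩ := hz
    rw [hol_proj hi hj]
    exact (hv.plaqueChained_of_proj_eq (hq := hi) (A.proj_emb (A.proj i ⟨p, hi⟩))).trans
      (hv.plaqueChained_of_proj_eq (hp := hj) (A.proj_emb (A.proj j ⟨p, hj⟩)).symm)
  | comp _ _ ihf ihg =>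
    rw [OpenPartialHomeomorph.trans_source] at hz
    exact (ihf hz.1).trans (ihg hz.2)
  | @symm f _ ih =>
    have h := ih (f.map_target hz)
    rw [f.right_inv hz] at h
    exact h.symm
  | restr s _ _ ih => exact ih hz.1

end IsShrinking

/-! ## Saturations -/

variable (A) in
/-- The saturation of `V` under the holonomy pseudo⋆group, consisting of the points which some
holonomy map takes to `V`. -/
def saturation (V : Set A.Trans) : Set A.Trans :=
  {z | ∃ γ, A.PseudoStarGroup γ ∧ z ∈ γ.source ∧ γ z ∈ V}

theorem isOpen_saturation {V : Set A.Trans} (hV : IsOpen V) : IsOpen (A.saturation V) := by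
  refine isOpen_iff_mem_nhds.2 ?_
  rintro z ⟨γ, hγ, hz, hzV⟩
  filter_upwards [γ.open_source.mem_nhds hz,
    (γ.continuousAt hz).preimage_mem_nhds (hV.mem_nhds hzV)] with w hw hwV
  exact ⟨γ, hγ, hw, hwV⟩

theorem subset_saturation (V : Set A.Trans) : V ⊆ A.saturation V := by
  intro z hz
  have hsource := proj_mem_source_hol (A.emb_mem_U z) (A.emb_mem_U z)
  have happly := hol_proj (A.emb_mem_U z) (A.emb_mem_U z)
  rw [A.proj_emb] at hsource happly
  exact ⟨_, .hol z.1 z.1, hsource, by rwa [happly]⟩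

variable (A) in
/-- A set of transverse points is invariant if the elementary holonomy maps preserve it, that is, if
it consists of the plaques contained in some union of leaves. -/
def IsHolonomyInvariant (B : Set A.Trans) : Prop :=
  ∀ (i j : Fin A.ν) (p : M) (hi : p ∈ (A.chart i).U) (hj : p ∈ (A.chart j).U),
    A.proj i ⟨p, hi⟩ ∈ B → A.proj j ⟨p, hj⟩ ∈ B

theorem isHolonomyInvariant_saturation (V : Set A.Trans) :
    A.IsHolonomyInvariant (A.saturation V) := by
  rintro i j p hi hj ⟨γ, hγ, hz, hV⟩
  refine ⟨(A.hol j i).trans γ, .comp (.hol j i) hγ, ?_, ?_⟩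
  · rw [OpenPartialHomeomorph.trans_source]
    exact ⟨proj_mem_source_hol hj hi, by rwa [mem_preimage, hol_proj hj hi]⟩
  · rwa [OpenPartialHomeomorph.coe_trans, Function.comp_apply, hol_proj hj hi]

variable (A) in
/-- The union in `M` of the plaques that belong to `B`. -/
def plaqueUnion (B : Set A.Trans) : Set M := ⋃ i, (↑) '' (A.proj i ⁻¹' B)

theorem mem_plaqueUnion {B : Set A.Trans} :
    p ∈ A.plaqueUnion B ↔ ∃ (i : Fin A.ν) (hi : p ∈ (A.chart i).U), A.proj i ⟨p, hi⟩ ∈ B := by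
  simp [plaqueUnion]

theorem isOpen_plaqueUnion {B : Set A.Trans} (hB : IsOpen B) : IsOpen (A.plaqueUnion B) :=
  isOpen_iUnion fun i => (A.chart i).isOpen_U.isOpenMap_subtype_val _
    (hB.preimage (A.continuous_proj i))

namespace IsHolonomyInvariant

variable {B : Set A.Trans}

theorem mem_plaqueUnion_iff (hB : A.IsHolonomyInvariant B) (hi : p ∈ (A.chart i).U) :
    p ∈ A.plaqueUnion B ↔ A.proj i ⟨p, hi⟩ ∈ B := by
  rw [mem_plaqueUnion]
  constructor
  · rintro ⟨j, hj, h⟩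
    exact hB j i p hj hi h
  · exact fun h => ⟨i, hi, h⟩

theorem compl (hB : A.IsHolonomyInvariant B) : A.IsHolonomyInvariant Bᶜ :=
  fun i j p hi hj h hj' => h (hB j i p hj hi hj')

theorem plaqueUnion_compl (hB : A.IsHolonomyInvariant B) :
    A.plaqueUnion Bᶜ = (A.plaqueUnion B)ᶜ := by
  ext p
  obtain ⟨i, hi⟩ := iUnion_eq_univ_iff.1 A.cover p
  rw [hB.compl.mem_plaqueUnion_iff hi, mem_compl_iff, mem_compl_iff, hB.mem_plaqueUnion_iff hi]

theorem eq_univ [PreconnectedSpace M] (hB : A.IsHolonomyInvariant B) (hclopen : IsClopen B)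
    (hne : B.Nonempty) : B = univ := by
  have emb_mem (z : A.Trans) : A.emb z ∈ A.plaqueUnion B ↔ z ∈ B := by
    rw [hB.mem_plaqueUnion_iff (A.emb_mem_U z), A.proj_emb]
  have isClosed_plaqueUnion : IsClosed (A.plaqueUnion B) := by
    rw [← isOpen_compl_iff, ← hB.plaqueUnion_compl]
    exact isOpen_plaqueUnion hclopen.compl.isOpen
  obtain ⟨x, hx⟩ := hne
  have huniv : A.plaqueUnion B = univ :=
    IsClopen.eq_univ ⟨isClosed_plaqueUnion, isOpen_plaqueUnion hclopen.isOpen⟩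
      ⟨A.emb x, (emb_mem x).2 hx⟩
  exact eq_univ_of_forall fun z => (emb_mem z).1 (huniv ▸ mem_univ _)

end IsHolonomyInvariant

end Top

/-! ## Equicontinuous holonomy -/

section Metric

variable {M : Type*} [MetricSpace M] {n : ℕ} {A : FoliatedAtlas M n}

theorem transDist_of_fst_eq {z w : A.Trans} (h : z.1 = w.1) :
    A.transDist z w = edist (A.emb z) (A.emb w) := if_pos h

theorem edist_emb_le_transDist (z w : A.Trans) :
    edist (A.emb z) (A.emb w) ≤ A.transDist z w := by
  unfold transDist
  split_ifs
  exacts [le_rfl, le_top]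

theorem eq_of_transDist_eq_zero {z w : A.Trans} (h : A.transDist z w = 0) : z = w :=
  A.emb_injective (edist_eq_zero.1 (le_antisymm (h ▸ edist_emb_le_transDist z w) bot_le))

theorem eventually_transDist_lt (z : A.Trans) {δ : ENNReal} (hδ : 0 < δ) :
    ∀ᶠ w in 𝓝 z, A.transDist w z < δ := by
  have same_chart : ∀ᶠ w in 𝓝 z, w.1 = z.1 :=
    ((isOpen_discrete {z.1}).preimage (f := Sigma.fst)
      (continuous_sigma fun _ => continuous_const)).mem_nhds rfl
  filter_upwards [same_chart, A.continuous_emb.continuousAt.preimage_mem_nhds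
    (Metric.eball_mem_nhds (A.emb z) hδ)] with w hw hwδ
  rwa [transDist_of_fst_eq hw]

theorem PlaqueChained.exists_pseudoStarGroup {v : Fin A.ν → Set M} {ε : ENNReal}
    (hhol : ∀ (i j : Fin A.ν) (p : M) (hp : p ∈ (A.chart i).U), p ∈ v i → p ∈ v j →
      ∀ w, A.transDist (A.proj i ⟨p, hp⟩) w < ε → w ∈ (A.hol i j).source)
    {z z' : A.Trans} (hz : A.emb z ∈ v z.1) (hzz' : A.transDist z z' < ε)
    (hclose : ∀ γ, A.PseudoStarGroup γ → z ∈ γ.source → z' ∈ γ.source →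
      A.transDist (γ z) (γ z') < ε)
    {q : M} (hq : A.PlaqueChained v (A.emb z) q) {j : Fin A.ν} (hqU : q ∈ (A.chart j).U)
    (hqv : q ∈ v j) :
    ∃ γ, A.PseudoStarGroup γ ∧ z ∈ γ.source ∧ z' ∈ γ.source ∧ γ z = A.proj j ⟨q, hqU⟩ := by
  induction hq generalizing j with
  | refl =>
    have hsource := proj_mem_source_hol (A.emb_mem_U z) hqU
    have happly := hol_proj (A.emb_mem_U z) hqU
    have hnear := hhol z.1 j _ (A.emb_mem_U z) hz hqv z'
    rw [A.proj_emb] at hsource happly hnear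
    exact ⟨_, .hol z.1 j, hsource, hnear hzz', happly⟩
  | @tail p q _ hpq ih =>
    obtain ⟨k, hpk, hqk, hpv, hqvk, hproj⟩ := hpq
    obtain ⟨γ, hγ, hzγ, hz'γ, hγz⟩ := ih hpk hpv
    rw [hproj] at hγz
    have hγz' : γ z' ∈ (A.hol k j).source :=
      hhol k j q hqk hqvk hqv _ (hγz ▸ hclose γ hγ hzγ hz'γ)
    refine ⟨γ.trans (A.hol k j), .comp hγ (.hol k j), ?_, ?_, ?_⟩
    · rw [OpenPartialHomeomorph.trans_source]
      exact ⟨hzγ, by rw [mem_preimage, hγz]; exact proj_mem_source_hol hqk hqU⟩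
    · rw [OpenPartialHomeomorph.trans_source]
      exact ⟨hz'γ, hγz'⟩
    · rw [OpenPartialHomeomorph.coe_trans, Function.comp_apply, hγz, hol_proj hqk hqU]

variable [CompactSpace M]

instance compactSpace_transversal (A : FoliatedAtlas M n) (i : Fin A.ν) :
    CompactSpace (A.chart i).T := by
  have : CompactSpace (A.chart i).K := isCompact_iff_compactSpace.1 (A.chart i).isClosed_K.isCompact
  have : CompactSpace (ClosedCube n × (A.chart i).T) := (A.chart i).φ.compactSpace
  have : Nonempty (ClosedCube n) := ⟨ClosedCube.center n⟩
  exact (Prod.snd_surjective (α := ClosedCube n)).compactSpace continuous_snd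

theorem exists_uniform_nhds {D O : Set A.Trans} (hD : IsCompact D) (hO : IsOpen O) (h : D ⊆ O) :
    ∃ ε > 0, ∀ z ∈ D, ∀ w, A.transDist z w < ε → w ∈ O := by
  have hdisj : Disjoint (A.emb '' D) (A.emb '' Oᶜ) :=
    (disjoint_image_iff A.emb_injective).2 (disjoint_compl_right_iff_subset.2 h)
  obtain ⟨ε, hε, hdist⟩ := hdisj.exists_thickenings (hD.image A.continuous_emb)
    (hO.isClosed_compl.isCompact.image A.continuous_emb).isClosed
  refine ⟨ENNReal.ofReal ε, ENNReal.ofReal_pos.2 hε, fun z hz w hzw => ?_⟩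
  by_contra hw
  refine disjoint_left.1 hdist ?_ (Metric.self_subset_thickening hε _ ⟨w, hw, rfl⟩)
  refine (Metric.mem_thickening_iff_exists_edist_lt _ _).2 ⟨A.emb z, ⟨z, hz, rfl⟩, ?_⟩
  rw [edist_comm]
  exact (edist_emb_le_transDist z w).trans_lt hzw

theorem isCompact_proj_image (i : Fin A.ν) {s : Set M} (hs : IsClosed s)
    (hsi : s ⊆ (A.chart i).U) : IsCompact (A.proj i '' ((↑) ⁻¹' s)) := by
  refine IsCompact.image ?_ (A.continuous_proj i)
  rw [Subtype.isCompact_iff, Subtype.image_preimage_coe, inter_eq_right.2 hsi]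
  exact hs.isCompact

theorem exists_isShrinking (A : FoliatedAtlas M n) :
    ∃ v, A.IsShrinking v ∧ ∀ z : A.Trans, A.emb z ∈ v z.1 := by
  have isClosed_center (i : Fin A.ν) : IsClosed (range fun t => A.emb ⟨i, t⟩) :=
    (isCompact_range (A.continuous_emb.comp continuous_sigmaMk)).isClosed
  obtain ⟨v, hvo, hv, hvU, hemb⟩ := exists_shrinking_of_isClosed_subset
    (fun i => (A.chart i).isOpen_U) (fun _ => toFinite _) A.cover isClosed_center
    (fun i => range_subset_iff.2 fun t => A.emb_mem_U ⟨i, t⟩)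
  exact ⟨v, ⟨hvo, hv, hvU⟩, fun z => hemb z.1 ⟨z.2, rfl⟩⟩

theorem IsShrinking.exists_uniform_nhds_hol {v : Fin A.ν → Set M} (hv : A.IsShrinking v) :
    ∃ ε > 0, ∀ (i j : Fin A.ν) (p : M) (hp : p ∈ (A.chart i).U), p ∈ v i → p ∈ v j →
      ∀ w, A.transDist (A.proj i ⟨p, hp⟩) w < ε → w ∈ (A.hol i j).source := by
  have exists_nhds (ij : Fin A.ν × Fin A.ν) :
      ∃ ε > 0, ∀ z ∈ A.proj ij.1 '' ((↑) ⁻¹' (closure (v ij.1) ∩ closure (v ij.2))),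
        ∀ w, A.transDist z w < ε → w ∈ (A.hol ij.1 ij.2).source := by
    refine exists_uniform_nhds (isCompact_proj_image ij.1 (isClosed_closure.inter isClosed_closure)
      (inter_subset_left.trans (hv.closure_subset ij.1))) (A.hol ij.1 ij.2).open_source ?_
    rintro _ ⟨p, ⟨-, hpj⟩, rfl⟩
    exact proj_mem_source_hol p.2 (hv.closure_subset ij.2 hpj)
  choose ε hε hw using exists_nhds
  refine ⟨Finset.univ.inf ε, (Finset.lt_inf_iff ENNReal.zero_lt_top).2 fun ij _ => hε ij, ?_⟩
  intro i j p hp hpi hpj w hpw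
  exact hw (i, j) _ ⟨⟨p, hp⟩, ⟨subset_closure hpi, subset_closure hpj⟩, rfl⟩ w
    (hpw.trans_le (Finset.inf_le (Finset.mem_univ _)))

namespace Equicontinuous

theorem exists_uniform_extension (hA : A.Equicontinuous) :
    ∃ δ > 0, ∀ η, A.PseudoStarGroup η → ∀ z ∈ η.source, ∀ z', A.transDist z z' < δ →
      ∃ γ, A.PseudoStarGroup γ ∧ z ∈ γ.source ∧ z' ∈ γ.source ∧ γ z = η z := by
  obtain ⟨v, hv, hemb⟩ := A.exists_isShrinking
  obtain ⟨ε, hε, hhol⟩ := hv.exists_uniform_nhds_hol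
  obtain ⟨δ, hδ, hequi⟩ := hA ε hε
  refine ⟨min δ ε, lt_min hδ hε, fun η hη z hz z' hzz' => ?_⟩
  have hclose (γ) (hγ : A.PseudoStarGroup γ) (hzγ : z ∈ γ.source) (hz'γ : z' ∈ γ.source) :
      A.transDist (γ z) (γ z') < ε :=
    hequi γ hγ z hzγ z' hz'γ (hzz'.trans_le (min_le_left _ _))
  have hextend := (hv.plaqueChained_of_pseudoStarGroup hη hz).exists_pseudoStarGroup hhol (hemb z)
    (hzz'.trans_le (min_le_right _ _)) hclose (A.emb_mem_U (η z)) (hemb (η z))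
  rwa [A.proj_emb] at hextend

theorem isClosed_saturation (hA : A.Equicontinuous) {V : Set A.Trans} (hV : IsClopen V) :
    IsClosed (A.saturation V) := by
  obtain ⟨ε, hε, hεV⟩ := exists_uniform_nhds hV.isClosed.isCompact hV.isOpen subset_rfl
  obtain ⟨δ₁, hδ₁, hextend⟩ := hA.exists_uniform_extension
  obtain ⟨δ₂, hδ₂, hequi⟩ := hA ε hε
  refine isClosed_of_closure_subset fun z' hz' => ?_
  obtain ⟨z, hzz', η, hη, hz, hzV⟩ :=
    mem_closure_iff_nhds.1 hz' _ (eventually_transDist_lt z' (lt_min hδ₁ hδ₂))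
  obtain ⟨γ, hγ, hzγ, hz'γ, hγz⟩ := hextend η hη z hz z' (lt_min_iff.1 hzz').1
  refine ⟨γ, hγ, hz'γ, hεV (γ z) (hγz ▸ hzV) _ ?_⟩
  exact hequi γ hγ z hzγ z' hz'γ (lt_min_iff.1 hzz').2

theorem saturation_eq_univ [PreconnectedSpace M] (hA : A.Equicontinuous) {V : Set A.Trans}
    (hV : IsClopen V) (hne : V.Nonempty) : A.saturation V = univ :=
  (isHolonomyInvariant_saturation V).eq_univ
    ⟨hA.isClosed_saturation hV, isOpen_saturation hV.isOpen⟩ (hne.mono (subset_saturation V))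

end Equicontinuous

end Metric

end FoliatedAtlas

/-! ## Transverse sections -/

namespace TransverseSection

variable {M : Type*} [MetricSpace M] {n : ℕ} {A : FoliatedAtlas M n} {G : Type*} [Group G]
  (S : TransverseSection A G)

theorem exists_nontrivial_germ [CompactSpace M] [PreconnectedSpace M] (hA : A.Equicontinuous)
    {m : M} (hm : A.LeafHasNontrivialHolonomy m) :
    ∃ (g : G) (y : S.V 0), S.Φ g y = y ∧ ¬ S.Φ g =ᶠ[𝓝 y] id := by
  obtain ⟨y, -, γ, hγ, hy, hfix, hgerm⟩ := hm
  obtain ⟨η, hη, hyη, hηV⟩ :=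
    (hA.saturation_eq_univ (S.isClopen 0) ⟨_, S.x_mem 0⟩).ge (mem_univ y)
  let conj := (η.symm.trans γ).trans η
  have hconj_source : η y ∈ conj.source := by simp [conj, hyη, hy, hfix]
  have hconj_fix : conj (η y) = η y := by simp [conj, hyη, hfix]
  obtain ⟨g, hg⟩ := S.generates conj (.comp (.comp (.symm hη) hγ) hη) ⟨η y, hηV⟩ hconj_source
    (by rwa [hconj_fix])
  refine ⟨g, ⟨η y, hηV⟩, Subtype.ext (hg.self_of_nhds.symm.trans hconj_fix), fun hid => hgerm ?_⟩
  refine eventuallyEq_id_of_conj_eventuallyEq_id η hyη (γ.continuousAt hy) hfix ?_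
  have hconj_id : ∀ᶠ w : S.V 0 in 𝓝 ⟨η y, hηV⟩, conj w = w := by
    filter_upwards [hg, hid] with w hgw hidw
    rw [hgw, hidw, id_eq]
  rwa [EventuallyEq, ← (S.isClopen 0).isOpen.isOpenEmbedding_subtypeVal.map_nhds_eq ⟨η y, hηV⟩]

variable {S} {g : G} {k l : ℕ} {v w : S.V 0}

theorem mem_stab_iff_of_mem (hv : v ∈ S.W l) : g ∈ S.stab l ↔ S.Φ g v ∈ S.W l := by
  have h1 : S.Φ 1 '' S.W l = S.W l := S.stab l |>.one_mem
  constructor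
  · intro hg
    exact (show S.Φ g '' S.W l = S.W l from hg) ▸ mem_image_of_mem _ hv
  · intro hgv
    exact (S.disjoint l g 1 ⟨S.Φ g v, mem_image_of_mem _ hv, h1.ge hgv⟩).trans h1

theorem exists_mem_stab_apply_eq (hkl : k ≤ l) (hv : v ∈ S.W k) :
    ∃ a ∈ S.stab k, ∃ w ∈ S.W l, S.Φ a w = v := by
  obtain ⟨a, w, hw, rfl⟩ := S.covers l v
  exact ⟨a, (mem_stab_iff_of_mem (S.anti hkl hw)).2 hv, w, hw, rfl⟩

theorem eq_of_frequently_mem_translate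
    (h : ∃ᶠ l in atTop, ∃ a : G, v ∈ S.Φ a '' S.W l ∧ w ∈ S.Φ a '' S.W l) : v = w := by
  refine Subtype.ext (FoliatedAtlas.eq_of_transDist_eq_zero ?_)
  refine le_antisymm (le_of_forall_gt fun ε hε => ?_) bot_le
  obtain ⟨L, hL⟩ := S.mesh ε hε
  obtain ⟨l, hl, a, hv, hw⟩ := frequently_atTop.1 h L
  exact hL l hl a v hv w hw

theorem apply_conj (a : G) : S.Φ a (S.Φ (a⁻¹ * g * a) v) = S.Φ g (S.Φ a v) := by
  rw [← Homeomorph.mul_apply, ← Homeomorph.mul_apply, ← map_mul, ← map_mul, mul_assoc,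
    mul_inv_cancel_left]

theorem conj_apply_eq_self {a : G} (h : S.Φ g (S.Φ a v) = S.Φ a v) :
    S.Φ (a⁻¹ * g * a) v = v :=
  (S.Φ a).injective ((apply_conj a).trans h)

theorem mem_core_truncate_of_apply_eq_self {m : ℕ}
    (hm : (S.chain.truncate k).sub m ≤ (S.chain.truncate k).core l) {g : S.chain.sub k}
    (hv : v ∈ S.W k) (hg : S.Φ g v = v) : g ∈ (S.chain.truncate k).core l := by
  obtain ⟨a, ha, w, hw, rfl⟩ := exists_mem_stab_apply_eq (Nat.le_add_right k m) hv
  let b : S.chain.sub k := ⟨a, ha⟩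
  have hconj : b⁻¹ * g * b ∈ (S.chain.truncate k).sub m :=
    Subgroup.mem_subgroupOf.2
      ((mem_stab_iff_of_mem hw).2 ((conj_apply_eq_self hg).symm ▸ hw))
  have hcore := (GroupChain.core_normal _ l).mem_comm (hm hconj)
  rwa [mul_inv_cancel_left] at hcore

theorem apply_eq_self_of_forall_mem_core_truncate {g : S.chain.sub k}
    (hg : ∀ l, g ∈ (S.chain.truncate k).core l) (hv : v ∈ S.W k) : S.Φ g v = v := by
  refine eq_of_frequently_mem_translate (frequently_atTop.2 fun l => ⟨k + l, by lia, ?_⟩)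
  obtain ⟨a, ha, w, hw, rfl⟩ := exists_mem_stab_apply_eq (Nat.le_add_right k l) hv
  let b : S.chain.sub k := ⟨a, ha⟩
  have hconj : b⁻¹ * g * b ∈ (S.chain.truncate k).core l := by
    simpa using (GroupChain.core_normal _ l).conj_mem g (hg l) b⁻¹
  have hstab : a⁻¹ * g * a ∈ S.stab (k + l) :=
    Subgroup.mem_subgroupOf.1 (Subgroup.normalCore_le _ hconj)
  exact ⟨a, ⟨_, (mem_stab_iff_of_mem hw).1 hstab, apply_conj a⟩, mem_image_of_mem _ hw⟩

theorem nontrivial_discriminant_truncate (hv : S.Φ g v = v) (hgerm : ¬ S.Φ g =ᶠ[𝓝 v] id) (k : ℕ) :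
    Nontrivial (S.chain.truncate k).discriminant := by
  rw [GroupChain.nontrivial_discriminant_iff]
  by_contra! hcore
  obtain ⟨a, w, hw, rfl⟩ := S.covers k v
  have hfix : S.Φ (a⁻¹ * g * a) w = w := conj_apply_eq_self hv
  let b : S.chain.sub k := ⟨a⁻¹ * g * a, (mem_stab_iff_of_mem hw).2 (hfix.symm ▸ hw)⟩
  have hb : ∀ l, b ∈ (S.chain.truncate k).core l := fun l =>
    (hcore l).elim fun _ hm => mem_core_truncate_of_apply_eq_self hm hw hfix
  have hopen : IsOpen (S.Φ a '' S.W k) :=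
    (S.Φ a).isOpenMap _ ((S.isClopen k).isOpen.preimage continuous_subtype_val)
  refine hgerm ?_
  filter_upwards [hopen.mem_nhds (mem_image_of_mem _ hw)]
  rintro _ ⟨u, hu, rfl⟩
  rw [← apply_conj, apply_eq_self_of_forall_mem_core_truncate hb hu, id_eq]

end TransverseSection

/-! ## Deck transformations of associated covers -/

namespace PathsFrom

variable {X E : Type*} [TopologicalSpace X] [TopologicalSpace E]

/-- The class of the constant path. -/
def const (x : X) : PathsFrom x := ⟨x, Path.Homotopic.Quotient.refl x⟩

theorem act_const {x : X} (g : FundamentalGroup X x) : act g (const x) = ⟨x, g⟩ :=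
  congrArg (Sigma.mk x) (Path.Homotopic.Quotient.trans_refl g)

theorem act_left_injective {x : X} (a : PathsFrom x) :
    Function.Injective fun g : FundamentalGroup X x => act g a := by
  obtain ⟨y, c⟩ := a
  intro g h hgh
  have htrans : Path.Homotopic.Quotient.trans g c = Path.Homotopic.Quotient.trans h c :=
    eq_of_heq (Sigma.mk.inj hgh).2
  simpa only [Path.Homotopic.Quotient.trans_assoc, Path.Homotopic.Quotient.trans_symm,
    Path.Homotopic.Quotient.trans_refl] using
    congrArg (fun d => Path.Homotopic.Quotient.trans d c.symm) htrans

theorem exists_act_eq {x : X} {a b : PathsFrom x} (h : a.1 = b.1) :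
    ∃ g : FundamentalGroup X x, act g a = b := by
  obtain ⟨y, c⟩ := a
  obtain ⟨z, d⟩ := b
  obtain rfl : y = z := h
  refine ⟨Path.Homotopic.Quotient.trans d c.symm, congrArg (Sigma.mk y) ?_⟩
  rw [Path.Homotopic.Quotient.trans_assoc, Path.Homotopic.Quotient.symm_trans,
    Path.Homotopic.Quotient.trans_refl]

theorem mk_eq_mk {x y z : X} {c : Path x y} {d : Path x z} (h : ∀ t, c t = d t) :
    (⟨y, Path.Homotopic.Quotient.mk c⟩ : PathsFrom x) = ⟨z, Path.Homotopic.Quotient.mk d⟩ := by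
  obtain rfl : y = z := by rw [← c.target, ← d.target, h]
  rw [Path.ext (funext h)]

theorem map_const (f : C(E, X)) {e : E} {x : X} (h : f e = x) : map f h (const e) = const x := by
  subst h
  rfl

end PathsFrom

namespace AssociatedCover

variable {X : Type*} [TopologicalSpace X] {x : X} {H N N' : Subgroup (FundamentalGroup X x)}

variable (H) in
/-- The point of the covering space associated to `H` that is represented by a class of paths. -/
def mk (a : PathsFrom x) : AssociatedCover x H := Quotient.mk (coverSetoid x H) a

theorem mk_surjective : Function.Surjective (mk H) := Quotient.mk_surjective

theorem mk_eq_mk {a b : PathsFrom x} : mk H a = mk H b ↔ ∃ h ∈ H, b = PathsFrom.act h a :=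
  Quotient.eq (r := coverSetoid x H)

/-- The covering projection to `X`. -/
def endPoint : AssociatedCover x H → X :=
  Quotient.lift Sigma.fst (by rintro a _ ⟨h, -, rfl⟩; rfl)

/-- The deck transformation of the covering space associated to the normal subgroup `N` that is
given by precomposition with a loop. -/
noncomputable def deck [hN : N.Normal] :
    FundamentalGroup X x ⧸ N → AssociatedCover x N → AssociatedCover x N :=
  Quotient.map₂ PathsFrom.act fun g g' hg a _ ⟨h, hh, ha⟩ => by
    refine ⟨g⁻¹ * h * g * (g⁻¹ * g'), N.mul_mem ?_ (QuotientGroup.leftRel_apply.1 hg), ?_⟩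
    · simpa only [inv_inv] using hN.conj_mem h hh g⁻¹
    · rw [ha, PathsFrom.act_act, PathsFrom.act_act]
      congr 1
      group

section Normal

variable [N.Normal]

theorem eq_one_of_deck_eq_self {q : FundamentalGroup X x ⧸ N} {z : AssociatedCover x N}
    (h : deck q z = z) : q = 1 := by
  obtain ⟨g, rfl⟩ := QuotientGroup.mk_surjective q
  obtain ⟨a, rfl⟩ := mk_surjective z
  obtain ⟨k, hk, hka⟩ := mk_eq_mk.1 h.symm
  rw [PathsFrom.act_left_injective a hka]
  exact (QuotientGroup.eq_one_iff k).2 hk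

theorem exists_deck_eq {z w : AssociatedCover x N} (h : endPoint z = endPoint w) :
    ∃ q, deck q z = w := by
  obtain ⟨a, rfl⟩ := mk_surjective z
  obtain ⟨b, rfl⟩ := mk_surjective w
  obtain ⟨g, rfl⟩ := PathsFrom.exists_act_eq h
  exact ⟨QuotientGroup.mk g, rfl⟩

theorem project_deck [N'.Normal] (hle : N ≤ N') (q : FundamentalGroup X x ⧸ N)
    (z : AssociatedCover x N) :
    project hle (deck q z) =
      deck (QuotientGroup.map N N' (MonoidHom.id _) hle q) (project hle z) := by
  obtain ⟨g, rfl⟩ := QuotientGroup.mk_surjective q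
  obtain ⟨a, rfl⟩ := mk_surjective z
  rfl

end Normal

end AssociatedCover

/-! ## Fibres of the Molino space -/

namespace Presentation

variable {n : ℕ} (P : Presentation.{u} n)

instance pathConnectedSpace (l : ℕ) : PathConnectedSpace (P.M l) := by
  have := ChartedSpace.locallyPathConnectedSpace (EuclideanSpace ℝ (Fin n)) (P.M l)
  exact pathConnectedSpace_iff_connectedSpace.2 inferInstance

theorem finite_q_preimage (l : ℕ) {t : Set (P.M 0)} (ht : t.Finite) : (P.q l ⁻¹' t).Finite := by
  induction l with
  | zero => exact ht
  | succ l ih =>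
    exact ih.preimage' fun y _ => finite_of_ncard_pos (zero_lt_one.trans (P.one_lt_degree l y))

variable (s : P.Solenoid) {l : ℕ}

variable {P s} in
theorem lift_eq_iff {a : PathsFrom (s.1 0)} {b : PathsFrom (s.1 l)} :
    P.lift s l a = b ↔ P.push s l b = a :=
  (Equiv.ofBijective _ (P.push_bijective s l)).symm_apply_eq.trans eq_comm

theorem lift_const : P.lift s l (PathsFrom.const _) = PathsFrom.const _ :=
  lift_eq_iff.2 (PathsFrom.map_const _ _)

theorem lift_mapOfEq_act (η : FundamentalGroup (P.M l) (s.1 l)) (a : PathsFrom (s.1 0)) :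
    P.lift s l (PathsFrom.act (FundamentalGroup.mapOfEq (P.q l) (P.q_apply s l) η) a) =
      PathsFrom.act η (P.lift s l a) :=
  lift_eq_iff.2 ((PathsFrom.map_act _ _ η _).trans (congrArg _ (P.push_lift s l a)))

variable {P s} in
theorem lift_fst_eq_iff {a b : PathsFrom (s.1 0)} :
    (P.lift s l a).1 = (P.lift s l b).1 ↔ ∃ g ∈ P.imageGroup s l, PathsFrom.act g a = b := by
  constructor
  · intro h
    obtain ⟨η, hη⟩ := PathsFrom.exists_act_eq h
    exact ⟨_, ⟨η, rfl⟩, by rw [← P.push_lift s l b, ← hη, ← lift_mapOfEq_act, push_lift]⟩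
  · rintro ⟨_, ⟨η, rfl⟩, rfl⟩
    rw [lift_mapOfEq_act]
    rfl

variable {P s} in
theorem lift_act_const_fst_eq_iff {g h : FundamentalGroup (P.M 0) (s.1 0)} :
    (P.lift s l (PathsFrom.act g (PathsFrom.const _))).1 =
      (P.lift s l (PathsFrom.act h (PathsFrom.const _))).1 ↔ g⁻¹ * h ∈ P.imageGroup s l := by
  simp only [lift_fst_eq_iff, PathsFrom.act_act, (PathsFrom.act_left_injective _).eq_iff,
    ← eq_inv_mul_iff_mul_eq, exists_eq_right]

variable {P s} in
theorem mem_imageGroup_iff {g : FundamentalGroup (P.M 0) (s.1 0)} :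
    g ∈ P.imageGroup s l ↔ (P.lift s l ⟨s.1 0, g⟩).1 = s.1 l := by
  have h := lift_act_const_fst_eq_iff (P := P) (s := s) (l := l) (g := 1) (h := g)
  rw [PathsFrom.act_one, lift_const, PathsFrom.act_const, inv_one, one_mul, eq_comm] at h
  exact h.symm

theorem finiteIndex_imageGroup (l : ℕ) : (P.imageGroup s l).FiniteIndex := by
  let fibre : Set (P.M l) := P.q l ⁻¹' {s.1 0}
  have : Finite fibre := (P.finite_q_preimage l (finite_singleton _)).to_subtype
  have q_lift (g : FundamentalGroup (P.M 0) (s.1 0)) :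
      P.q l (P.lift s l (PathsFrom.act g (PathsFrom.const _))).1 = s.1 0 :=
    congrArg Sigma.fst (P.push_lift s l (PathsFrom.act g (PathsFrom.const _)))
  let translate : FundamentalGroup (P.M 0) (s.1 0) ⧸ P.imageGroup s l → fibre :=
    Quotient.lift (fun g => ⟨_, q_lift g⟩) fun _ _ h =>
      Subtype.ext (lift_act_const_fst_eq_iff.2 (QuotientGroup.leftRel_apply.1 h))
  have translate_injective : Function.Injective translate := by
    rintro ⟨g⟩ ⟨h⟩ hgh
    exact QuotientGroup.eq.2 (lift_act_const_fst_eq_iff.1 (congrArg Subtype.val hgh))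
  have := Finite.of_injective _ translate_injective
  exact Subgroup.finiteIndex_of_finite_quotient

/-- The group chain in `π₁(M_0, s_0)` of the images of the groups `π₁(M_l, s_l)`. -/
noncomputable def chain : GroupChain (FundamentalGroup (P.M 0) (s.1 0)) where
  sub := P.imageGroup s
  sub_zero := by
    refine eq_top_iff.2 fun g _ => mem_imageGroup_iff.2 ?_
    exact congrArg Sigma.fst (P.push_lift s 0 ⟨_, g⟩)
  anti := antitone_nat_of_succ_le (P.imageGroup_succ_le s)
  finiteIndex := P.finiteIndex_imageGroup s

instance coreGroup_normal (l : ℕ) : (P.coreGroup s l).Normal := Subgroup.normalCore_normal _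

theorem q_stageMap (z : P.MolinoStage s l) :
    P.q l (P.stageMap s l z) = AssociatedCover.endPoint z := by
  obtain ⟨a, rfl⟩ := AssociatedCover.mk_surjective z
  exact congrArg Sigma.fst (P.push_lift s l a)

theorem stageMap_surjective (l : ℕ) : Function.Surjective (P.stageMap s l) := by
  intro y
  obtain ⟨c⟩ := PathConnectedSpace.joined (s.1 l) y
  refine ⟨.mk _ (P.push s l ⟨y, Path.Homotopic.Quotient.mk c⟩), ?_⟩
  exact congrArg Sigma.fst (lift_eq_iff.2 rfl)

theorem stageMap_deck {d : FundamentalGroup (P.M 0) (s.1 0) ⧸ P.coreGroup s l}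
    (hd : d ∈ (P.imageGroup s l).map (QuotientGroup.mk' (P.coreGroup s l)))
    (z : P.MolinoStage s l) : P.stageMap s l (AssociatedCover.deck d z) = P.stageMap s l z := by
  obtain ⟨g, hg, rfl⟩ := hd
  obtain ⟨a, rfl⟩ := AssociatedCover.mk_surjective z
  exact (lift_fst_eq_iff.2 ⟨g, hg, rfl⟩).symm

theorem finite_stageMap_fibre (l : ℕ) (y : P.M l) : (P.stageMap s l ⁻¹' {y}).Finite := by
  have := P.finiteIndex_imageGroup s l
  have : (P.coreGroup s l).FiniteIndex := Subgroup.finiteIndex_normalCore _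
  obtain ⟨z, rfl⟩ := P.stageMap_surjective s l y
  refine (finite_range fun d => AssociatedCover.deck d z).subset fun w hw => ?_
  exact AssociatedCover.exists_deck_eq (by rw [← q_stageMap, ← q_stageMap, hw])

theorem molinoMap_surjective : Function.Surjective (P.molinoMap s) := by
  intro y
  obtain ⟨z, hz, hproject⟩ := exists_compatible_sequence
    (fun l => AssociatedCover.project (P.coreGroup_succ_le s l))
    (fun l => P.stageMap s l ⁻¹' {y.1 l}) (fun l => P.finite_stageMap_fibre s l (y.1 l))
    (fun l => P.stageMap_surjective s l (y.1 l)) (fun l z hz => by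
      rw [mem_preimage, ← p_stageMap, hz]
      exact y.2 l)
  exact ⟨⟨z, hproject⟩, Subtype.ext (funext hz)⟩

theorem nontrivial_molinoMap_fibre (h : Nontrivial (P.chain s).discriminant) (y : P.Solenoid) :
    (P.molinoMap s ⁻¹' {y}).Nontrivial := by
  obtain ⟨z, rfl⟩ := P.molinoMap_surjective s y
  obtain ⟨⟨d, hdsub, hdbond⟩, hd⟩ := exists_ne (1 : (P.chain s).discriminant)
  let w (l : ℕ) : P.MolinoStage s l := AssociatedCover.deck (N := P.coreGroup s l) (d l) (z.1 l)
  have project_w (l : ℕ) :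
      AssociatedCover.project (P.coreGroup_succ_le s l) (w (l + 1)) = w l := by
    refine (AssociatedCover.project_deck _ _ _).trans ?_
    exact congrArg₂ _ (hdbond l) (z.2 l)
  refine ⟨z, rfl, ⟨w, project_w⟩, ?_, fun hzw => hd ?_⟩
  · exact Subtype.ext (funext fun l => P.stageMap_deck s (hdsub l) (z.1 l))
  · refine Subtype.ext (funext fun l => ?_)
    exact AssociatedCover.eq_one_of_deck_eq_self (congrFun (congrArg Subtype.val hzw) l).symm

end Presentation

namespace TransverseSection.Realization

variable {M : Type u} [MetricSpace M] {n : ℕ} {A : FoliatedAtlas M n} {G : Type*} [Group G]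
  {S : TransverseSection A G} {P : Presentation.{u} n} (R : S.Realization P)

theorem e_mem_imageGroup_iff (l : ℕ) (g : G) :
    R.e g ∈ P.imageGroup (R.Θ (A.emb S.x)) l ↔ g ∈ S.stab l := by
  obtain ⟨c, h₀, h₁, hc⟩ := R.monodromy g S.base
  have continuous_coord : Continuous fun s : P.Solenoid => s.1 l :=
    (continuous_apply l).comp continuous_subtype_val
  have lift_loop : P.lift (R.Θ (A.emb S.x)) l ⟨_, R.e g⟩ =
      ⟨_, Path.Homotopic.Quotient.mk (c.map continuous_coord)⟩ := by
    rw [Presentation.lift_eq_iff, hc]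
    exact PathsFrom.mk_eq_mk fun t => P.q_apply (c t) l
  have mem_image : R.Θ (A.emb (S.Φ g S.base)) ∈ (fun z => R.Θ (A.emb z)) '' S.V l ↔
      (S.Φ g S.base : A.Trans) ∈ S.V l :=
    (R.Θ.injective.comp A.emb_injective).mem_set_image
  rw [R.image_V l] at mem_image
  rw [Presentation.mem_imageGroup_iff, lift_loop, S.mem_stab_iff]
  exact mem_image

theorem nontrivial_discriminant_chain (h : Nontrivial (S.chain.truncate 0).discriminant) :
    Nontrivial (P.chain (R.Θ (A.emb S.x))).discriminant := by
  let e : S.chain.sub 0 ≃* FundamentalGroup (P.M 0) ((R.Θ (A.emb S.x)).1 0) :=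
    ((MulEquiv.subgroupCongr S.chain.sub_zero).trans Subgroup.topEquiv).trans R.e
  refine (GroupChain.nontrivial_discriminant_congr e fun l g => ?_).1 h
  change R.e g ∈ P.imageGroup _ l ↔ (g : G) ∈ S.stab (0 + l)
  rw [Nat.zero_add, R.e_mem_imageGroup_iff]

end TransverseSection.Realization

theorem mainTheorem5 {M : Type u} [MetricSpace M] [CompactSpace M] [ConnectedSpace M] {n : ℕ}
    (A : FoliatedAtlas M n) (hA : A.Equicontinuous)
    (hL : ∃ m : M, A.LeafHasNontrivialHolonomy m)
    {G : Type*} [Group G] (S : TransverseSection A G) :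
    (∀ k : ℕ, Nontrivial (S.chain.truncate k).discriminant) ∧
    (∀ (P : Presentation.{u} n) (R : S.Realization P) (s : P.Solenoid),
      (P.molinoMap (R.Θ (A.emb S.x)) ⁻¹' {s}).Nontrivial) := by
  obtain ⟨m, hm⟩ := hL
  obtain ⟨g, v, hv, hgerm⟩ := S.exists_nontrivial_germ hA hm
  have hdisc (k : ℕ) : Nontrivial (S.chain.truncate k).discriminant :=
    TransverseSection.nontrivial_discriminant_truncate hv hgerm k
  refine ⟨hdisc, fun P R s => ?_⟩
  exact P.nontrivial_molinoMap_fibre _ (R.nontrivial_discriminant_chain (hdisc 0)) s
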